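/- Let $m\ge 0$, $n\ge 1$, and let $f:\mathbb R^m\times\mathbb R^n\to\mathbb R$ be differentiable and $\ell$-smooth, i.e. $\|\nabla f(x_1,y_1)-\nabla f(x_2,y_2)\|^2\le \ell^2\|x_1-x_2\|^2+\ell^2\|y_1-y_2\|^2$, with $f(x,\cdot)$ $\mu$-strongly concave for every $x$ ($\ell,\mu>0$). Put $\kappa=\ell/\mu$, $\Phi(x)=\max_y f(x,y)$, $y^*(x)=\arg\max_y f(x,y)$, and assume $\inf\Phi>-\infty$. Let $G_x(x,y,\xi^x)$ and $G_y(x,y,\xi^y)$ be unbiased estimators of $\nabla_x f(x,y)$ and $\nabla_y f(x,y)$ with variance $\mathbb E\|G-\nabla f\|^2\le\sigma^2$, and let $g_{x}$ (resp. $g_y$) denote the average of $M_x$ (resp. $M_y$) i.i.d. copies of $G_x$ (resp. $G_y$) at a point, with fresh samples at every point queried. Let $\epsilon>0$. **Stochastic EG.** From deterministic $(x_0,y_0)$ iterate, for $t\ge 0$, $$x_{t+1/2}=x_t-\eta_x g_{x,t},\quad y_{t+1/2}=y_t+\eta_y g_{y,t},\quad x_{t+1}=x_t-\eta_x g_{x,t+1/2},\quad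 y_{t+1}=y_t+\eta_y g_{y,t+1/2},$$ with $\eta_x=\frac{c}{\kappa^2\ell}$, $0<c\le\frac1{75}$, $\eta_y=\frac{1}{4\ell}$, and $M_x=M_y=\lceil\max\{1,\kappa\sigma^2/\epsilon^2\}\rceil$. Let $\Delta_\Phi=\Phi(x_0)-\inf\Phi$, $D_0=\|y_0-y^*(x_0)\|^2$, and let $\bar x$ be uniformly distributed on $x_0,\dots,x_{T-1}$ (index independent of the samples). **Stochastic OGDA.** From deterministic $(x_0,y_0),(x_1,y_1)$ iterate, for $t\ge1$, $$x_{t+1}=x_t-\eta_x g_{x,t}-\eta_x(g_{x,t}-g_{x,t-1}),\qquad y_{t+1}=y_t+\eta_y g_{y,t}+\eta_y(g_{y,t}-g_{y,t-1}),$$ with $\eta_x=\frac{c}{\kappa^2\ell}$, $0<c\le\frac1{50}$, $\eta_y=\frac1{6\ell}$, $M_x=\lceil\max\{1,\sigma^2/\epsilon^2\}\rceil$, $M_y=\lceil\max\{1,\kappa\sigma^2/\epsilon^2\}\rceil$. Let $\Delta_\Phi=\max(\Phi(x_0),\Phi(x_1))-\inf\Phi$, $D_0=\max(\|x_1-x_0\|^2,\|y_1-y_0\|^2,\|y_1-y^*(x_1)\|^2,\|y_0-y^*(x_0)\|^2)$,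 and let $\bar x$ be uniformly distributed on $x_1,\dots,x_T$ (index independent of the samples). **Claim.** $\Phi$ is differentiable, and there are universal constants $C,K>0$ such that for both methods, with $$T_0=\max\Big\{1,\Big\lceil C\,\frac{\kappa^2\ell\Delta_\Phi/c+\kappa\ell^2D_0}{\epsilon^2}\Big\rceil\Big\},$$ every $T\ge T_0$ gives $\mathbb E\|\nabla\Phi(\bar x)\|^2\le\epsilon^2$. If moreover $\epsilon\le1$, the total number of stochastic gradient evaluations in $T_0$ iterations is at most $K\,(1+\ell\Delta_\Phi/c+\ell^2D_0)(1+\sigma^2)\,\kappa^3/\epsilon^4$; in particular, for the largest stepsizes ($c=\frac1{75}$, resp. $c=\frac1{50}$), $T_0=O\big((\kappa^2\ell\Delta_\Phi+\kappa\ell^2D_0)/\epsilon^2\big)$ (up to rounding to a positive integer) and the gradient complexity is $O(\kappa^3/\epsilon^4)$ for fixed $\ell,\Delta_\Phi,D_0,\sigma$. -/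

import Mathlib

open MeasureTheory ProbabilityTheory

noncomputable section

namespace Minimax

/-- `ℝᵈ` with the Euclidean norm. -/
abbrev Vec (d : ℕ) : Type := EuclideanSpace ℝ (Fin d)

section Objective

variable {m n : ℕ}

/-- The partial gradient `∇ₓ f(x, y)`. -/
def gradX (f : Vec m → Vec n → ℝ) (x : Vec m) (y : Vec n) : Vec m :=
  gradient (fun x' => f x' y) x

/-- The partial gradient `∇_y f(x, y)`. -/
def gradY (f : Vec m → Vec n → ℝ) (x : Vec m) (y : Vec n) : Vec n :=
  gradient (fun y' => f x y') y

/-- `f` is (jointly) differentiable and `∇f = (∇ₓ f, ∇_y f)` is `ℓ`-Lipschitz for the Euclidean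
norm of `ℝᵐ × ℝⁿ`. -/
structure IsSmooth (f : Vec m → Vec n → ℝ) (ℓ : ℝ) : Prop where
  differentiable : Differentiable ℝ (fun p : Vec m × Vec n => f p.1 p.2)
  lipschitz : ∀ (x₁ x₂ : Vec m) (y₁ y₂ : Vec n),
    ‖gradX f x₁ y₁ - gradX f x₂ y₂‖ ^ 2 + ‖gradY f x₁ y₁ - gradY f x₂ y₂‖ ^ 2
      ≤ ℓ ^ 2 * ‖x₁ - x₂‖ ^ 2 + ℓ ^ 2 * ‖y₁ - y₂‖ ^ 2

/-- `f(x, ·)` is `μ`-strongly concave for every `x` (first-order form, for differentiable `f`). -/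
def IsStronglyConcave (f : Vec m → Vec n → ℝ) (μ : ℝ) : Prop :=
  ∀ (x : Vec m) (y₁ y₂ : Vec n),
    f x y₂ ≤ f x y₁ + inner ℝ (gradY f x y₁) (y₂ - y₁) - μ / 2 * ‖y₁ - y₂‖ ^ 2

/-- The primal function `Φ(x) = max_y f(x, y)`. -/
def primal (f : Vec m → Vec n → ℝ) (x : Vec m) : ℝ :=
  ⨆ y : Vec n, f x y

/-- `y*(x)`, a maximizer of `f(x, ·)` (it exists and is unique under strong concavity). -/
def argmaxY (f : Vec m → Vec n → ℝ) (x : Vec m) : Vec n :=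
  Classical.epsilon fun y : Vec n => ∀ y' : Vec n, f x y' ≤ f x y

end Objective

section Oracle

/-- `G x y ξ`, with `ξ` of law `ν`, is an unbiased estimator of the vector field `g x y`, of
variance at most `σ²`. -/
structure IsStochasticOracle {m n d : ℕ} {Ξ : Type*} [MeasurableSpace Ξ] (ν : Measure Ξ)
    (g : Vec m → Vec n → Vec d) (G : Vec m → Vec n → Ξ → Vec d) (σ : ℝ) : Prop where
  measurable : Measurable (fun p : (Vec m × Vec n) × Ξ => G p.1.1 p.1.2 p.2)
  integrable : ∀ x y, Integrable (G x y) ν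
  unbiased : ∀ x y, ∫ ξ, G x y ξ ∂ν = g x y
  integrable_sq : ∀ x y, Integrable (fun ξ => ‖G x y ξ - g x y‖ ^ 2) ν
  variance_le : ∀ x y, ∫ ξ, ‖G x y ξ - g x y‖ ^ 2 ∂ν ≤ σ ^ 2

/-- The minibatch estimator `(1/M) ∑ᵢ G(x, y, ξᵢ)` at the point `p = (x, y)`. -/
def minibatch {m n d M : ℕ} {Ξ : Type*} (G : Vec m → Vec n → Ξ → Vec d) (ξ : Fin M → Ξ)
    (p : Vec m × Vec n) : Vec d :=
  (M : ℝ)⁻¹ • ∑ i, G p.1 p.2 (ξ i)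

/-- All the samples drawn in oracle rounds `0, 1, 2, …`, as one random element. -/
def allSamples {Ω Ξx Ξy : Type*} {Mx My : ℕ}
    (ξx : ℕ → Fin Mx → Ω → Ξx) (ξy : ℕ → Fin My → Ω → Ξy) (ω : Ω) :
    ℕ → (Fin Mx → Ξx) × (Fin My → Ξy) :=
  fun k => (fun i => ξx k i ω, fun j => ξy k j ω)

/-- In oracle round `k` one draws the i.i.d. primal minibatch `ξx k 0, …, ξx k (Mx - 1)` of law
`νx` and the i.i.d. dual minibatch `ξy k 0, …, ξy k (My - 1)` of law `νy`; different rounds are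
independent. (The two minibatches of one round may depend on each other.) -/
structure IsSampling {Ω Ξx Ξy : Type*} [MeasurableSpace Ω] [MeasurableSpace Ξx]
    [MeasurableSpace Ξy] (P : Measure Ω) (νx : Measure Ξx) (νy : Measure Ξy) {Mx My : ℕ}
    (ξx : ℕ → Fin Mx → Ω → Ξx) (ξy : ℕ → Fin My → Ω → Ξy) : Prop where
  law_x : ∀ k i, MeasurePreserving (ξx k i) P νx
  law_y : ∀ k j, MeasurePreserving (ξy k j) P νy
  indep_x : ∀ k, iIndepFun (fun i => ξx k i) P
  indep_y : ∀ k, iIndepFun (fun j => ξy k j) P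
  indep_rounds : iIndepFun (fun k ω => allSamples ξx ξy ω k) P

/-- `τ` is uniformly distributed on the finite set `S` and independent of `Z`. -/
structure IsUniformIndex {Ω A : Type*} [MeasurableSpace Ω] [MeasurableSpace A] (P : Measure Ω)
    (S : Finset ℕ) (Z : Ω → A) (τ : Ω → ℕ) : Prop where
  measurable : Measurable τ
  uniform : ∀ t ∈ S, P.real {ω | τ ω = t} = 1 / (S.card : ℝ)
  indep : IndepFun τ Z P

end Oracle

section Algorithms

variable {m n Mx My : ℕ} {Ξx Ξy : Type*}

/-- Stochastic extragradient started at `p₀ = (x₀, y₀)`: the iterates `(x_t, y_t)`, `t = 0, 1, …`,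
as a function of the samples `s`. The gradients at `(x_t, y_t)` use round `2t`, those at the
midpoint `(x_{t+1/2}, y_{t+1/2})` use round `2t + 1`. -/
def eg (Gx : Vec m → Vec n → Ξx → Vec m) (Gy : Vec m → Vec n → Ξy → Vec n) (ηx ηy : ℝ)
    (p₀ : Vec m × Vec n) (s : ℕ → (Fin Mx → Ξx) × (Fin My → Ξy)) : ℕ → Vec m × Vec n
  | 0 => p₀
  | t + 1 =>
    let p := eg Gx Gy ηx ηy p₀ s t
    let q : Vec m × Vec n :=
      (p.1 - ηx • minibatch Gx (s (2 * t)).1 p,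
       p.2 + ηy • minibatch Gy (s (2 * t)).2 p)
    (p.1 - ηx • minibatch Gx (s (2 * t + 1)).1 q,
     p.2 + ηy • minibatch Gy (s (2 * t + 1)).2 q)

/-- Stochastic optimistic gradient descent ascent started at `p₀ = (x₀, y₀)`, `p₁ = (x₁, y₁)`:
`x_{t+1} = x_t - ηx g_{x,t} - ηx (g_{x,t} - g_{x,t-1})`,
`y_{t+1} = y_t + ηy g_{y,t} + ηy (g_{y,t} - g_{y,t-1})` for `t ≥ 1`, where `g_{·,t}` is the
minibatch gradient at `(x_t, y_t)` with the samples of round `t`. -/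
def ogda (Gx : Vec m → Vec n → Ξx → Vec m) (Gy : Vec m → Vec n → Ξy → Vec n) (ηx ηy : ℝ)
    (p₀ p₁ : Vec m × Vec n) (s : ℕ → (Fin Mx → Ξx) × (Fin My → Ξy)) : ℕ → Vec m × Vec n
  | 0 => p₀
  | 1 => p₁
  | t + 2 =>
    let q := ogda Gx Gy ηx ηy p₀ p₁ s t
    let p := ogda Gx Gy ηx ηy p₀ p₁ s (t + 1)
    let gx := minibatch Gx (s (t + 1)).1 p
    let gx' := minibatch Gx (s t).1 q
    let gy := minibatch Gy (s (t + 1)).2 p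
    let gy' := minibatch Gy (s t).2 q
    (p.1 - ηx • gx - ηx • (gx - gx'), p.2 + ηy • gy + ηy • (gy - gy'))

/-- Stochastic gradient evaluations in `T` iterations of EG: in each of them a primal and a dual
minibatch at the current point, and again at the midpoint. -/
def egOracleCalls (Mx My T : ℕ) : ℕ := ∑ _t ∈ Finset.range T, ((Mx + My) + (Mx + My))

/-- Stochastic gradient evaluations in rounds `0, …, T - 1` of OGDA, those that determine
`x_1, …, x_T`: one primal and one dual minibatch per round (the previous ones are reused). -/
def ogdaOracleCalls (Mx My T : ℕ) : ℕ := ∑ _t ∈ Finset.range T, (Mx + My)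

end Algorithms

/-- The minibatch size `max {1, r}`, rounded up to an integer. -/
def batchSize (r : ℝ) : ℕ := ⌈max 1 r⌉₊

/-- The least positive integer that is at least `r`. -/
def iterationCount (r : ℝ) : ℕ := max 1 ⌈r⌉₊

end Minimax

end

/-! Both methods are driven by one deterministic inequality, `IsProblem.exists_step`. A base point
`(x, y)` is extrapolated along `(a, b)` and then moved along noisy gradients `v + ex`, `w + ey`
taken at the extrapolated point. The potential is `Φ(x) - inf Φ` plus a weight times the tracking
error `‖y - y*(x)‖²`. By Danskin, `∇Φ(x) = ∇ₓf(x, y*(x))`, and `y*` is `κ`-Lipschitz, so `Φ` has a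
quadratic upper bound of curvature `3κℓ` (`primal_le_add`). Using `v` in place of `∇Φ(x)` costs `ηx
ℓ²/2` times the squared tracking error of the extrapolated `y`; the weight is chosen so that strong
concavity at that same point pays for it. The drift of `y*(x)` during the step costs a multiple of
`c² ηx`, because `ηx` is of order `c/(κ²ℓ)`.

What remains is `‖w - b‖²`, the change of the dual gradient under extrapolation. In EG, `b` is a
fresh minibatch gradient at the base point, and smoothness with a small `ηy` makes the change
smaller than `‖b‖²`, up to noise (`IsProblem.egMidpoint_le`). OGDA is past extragradient: with the
last minibatch gradient `(a, b)`, its point `(x, y)` is the extrapolation of the base point `(x + ηx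
a, y - ηy b)`. Here `b` belongs to the previous point and carries old noise, so the potential also
stores the distance from the base point to the previous point, `‖a‖²`, and the old dual error
(`IsProblem.exists_ogda_step`).

The new noise enters through linear terms, whose coefficients are fixed before the round is drawn,
and through squares. Freezing the past therefore kills the linear terms and leaves `σ²/M`. The
primal square has weight `O(ηx)`, the dual one `O(ηx κ)`, whence the factor `κ` in the dual batch.
All potentials are nonnegative, so expectations are taken as lower Lebesgue integrals and no
integrability of the iterates is needed. The descent is telescoped and averaged over the independent
index. -/

noncomputable section

namespace Minimax

/-! ### Calculus of the objective, the maximizer map and the primal function. -/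

section Objective

variable {m n : ℕ} {f : Vec m → Vec n → ℝ} {ℓ μ κ : ℝ}

/-- A differentiable function whose gradient is `L`-Lipschitz at `x` differs from its first-order
expansion at `x` by at most `L / 2 * ‖z - x‖ ^ 2`. -/
lemma le_add_inner_add_of_gradient_lipschitz {E : Type*} [NormedAddCommGroup E]
    [InnerProductSpace ℝ E] [CompleteSpace E] {F : E → ℝ} {G : E → E} {L : ℝ} {x : E}
    (hF : ∀ z, HasGradientAt F (G z) z) (hG : ∀ z, ‖G z - G x‖ ≤ L * ‖z - x‖) (z : E) :
    F z ≤ F x + inner ℝ (G x) (z - x) + L / 2 * ‖z - x‖ ^ 2 := by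
  set d := z - x with hd
  let ψ : ℝ → ℝ := fun t => F (x + t • d) - t * inner ℝ (G x) d - L / 2 * t ^ 2 * ‖d‖ ^ 2
  have hψ : ∀ t, HasDerivAt ψ (inner ℝ (G (x + t • d)) d - inner ℝ (G x) d - L * t * ‖d‖ ^ 2) t := by
    intro t
    have h1 : HasDerivAt (fun t : ℝ => x + t • d) d t := by
      simpa using ((hasDerivAt_id t).smul_const d).const_add x
    have h2 : HasDerivAt (fun t : ℝ => F (x + t • d)) (inner ℝ (G (x + t • d)) d) t := by
      have := (hF (x + t • d)).hasFDerivAt.comp_hasDerivAt t h1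
      rw [InnerProductSpace.toDual_apply_apply] at this
      exact this
    have h3 : HasDerivAt (fun t : ℝ => t * inner ℝ (G x) d) (inner ℝ (G x) d) t := by
      simpa using (hasDerivAt_id t).mul_const (inner ℝ (G x) d)
    have h4 : HasDerivAt (fun t : ℝ => L / 2 * t ^ 2 * ‖d‖ ^ 2) (L * t * ‖d‖ ^ 2) t := by
      have := (((hasDerivAt_id t).pow 2).const_mul (L / 2)).mul_const (‖d‖ ^ 2)
      refine this.congr_deriv ?_
      norm_num
      left
      ring
    exact (h2.sub h3).sub h4
  have hanti : AntitoneOn ψ (Set.Icc 0 1) := by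
    refine antitoneOn_of_deriv_nonpos (convex_Icc 0 1)
      (fun t _ => (hψ t).continuousAt.continuousWithinAt)
      (fun t _ => (hψ t).differentiableAt.differentiableWithinAt) fun t ht => ?_
    rw [interior_Icc] at ht
    rw [(hψ t).deriv, ← inner_sub_left]
    have h1 := real_inner_le_norm (G (x + t • d) - G x) d
    have h2 := hG (x + t • d)
    rw [add_sub_cancel_left, norm_smul, Real.norm_of_nonneg ht.1.le] at h2
    have h3 := mul_le_mul_of_nonneg_right h2 (norm_nonneg d)
    nlinarith
  have h := hanti (Set.left_mem_Icc.2 zero_le_one) (Set.right_mem_Icc.2 zero_le_one) zero_le_one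
  simp only [ψ, one_smul, zero_smul, add_zero, one_mul, zero_mul, one_pow, mul_one, ne_eq,
    OfNat.ofNat_ne_zero, not_false_eq_true, zero_pow, mul_zero, sub_zero] at h
  rw [hd, add_sub_cancel, ← hd] at h
  linarith

lemma IsSmooth.hasGradientAt_gradX (h : IsSmooth f ℓ) (x : Vec m) (y : Vec n) :
    HasGradientAt (fun x' => f x' y) (gradX f x y) x :=
  DifferentiableAt.hasGradientAt
    ((h.differentiable (x, y)).comp (f := fun x' : Vec m => (x', y)) x (by fun_prop))

lemma IsSmooth.hasGradientAt_gradY (h : IsSmooth f ℓ) (x : Vec m) (y : Vec n) :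
    HasGradientAt (fun y' => f x y') (gradY f x y) y :=
  DifferentiableAt.hasGradientAt
    ((h.differentiable (x, y)).comp (f := fun y' : Vec n => (x, y')) y (by fun_prop))

lemma IsSmooth.gradX_lipschitz_left (h : IsSmooth f ℓ) (hℓ : 0 < ℓ) (x₁ x₂ : Vec m) (y : Vec n) :
    ‖gradX f x₁ y - gradX f x₂ y‖ ≤ ℓ * ‖x₁ - x₂‖ := by
  have := h.lipschitz x₁ x₂ y y
  refine abs_le_of_sq_le_sq' ?_ (by positivity) |>.2
  simp only [sub_self, norm_zero] at this
  nlinarith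

lemma IsSmooth.gradX_lipschitz_right (h : IsSmooth f ℓ) (hℓ : 0 < ℓ) (x : Vec m) (y₁ y₂ : Vec n) :
    ‖gradX f x y₁ - gradX f x y₂‖ ≤ ℓ * ‖y₁ - y₂‖ := by
  have := h.lipschitz x x y₁ y₂
  refine abs_le_of_sq_le_sq' ?_ (by positivity) |>.2
  simp only [sub_self, norm_zero] at this
  nlinarith [sq_nonneg ‖gradY f x y₁ - gradY f x y₂‖]

lemma IsSmooth.gradY_lipschitz_left (h : IsSmooth f ℓ) (hℓ : 0 < ℓ) (x₁ x₂ : Vec m) (y : Vec n) :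
    ‖gradY f x₁ y - gradY f x₂ y‖ ≤ ℓ * ‖x₁ - x₂‖ := by
  have := h.lipschitz x₁ x₂ y y
  refine abs_le_of_sq_le_sq' ?_ (by positivity) |>.2
  simp only [sub_self, norm_zero] at this
  nlinarith [sq_nonneg ‖gradX f x₁ y - gradX f x₂ y‖]

lemma IsSmooth.gradY_lipschitz_right (h : IsSmooth f ℓ) (hℓ : 0 < ℓ) (x : Vec m) (y₁ y₂ : Vec n) :
    ‖gradY f x y₁ - gradY f x y₂‖ ≤ ℓ * ‖y₁ - y₂‖ := by
  have := h.lipschitz x x y₁ y₂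
  refine abs_le_of_sq_le_sq' ?_ (by positivity) |>.2
  simp only [sub_self, norm_zero] at this
  nlinarith [sq_nonneg ‖gradX f x y₁ - gradX f x y₂‖]

lemma IsSmooth.sq_gradX_sub_le (h : IsSmooth f ℓ) (x₁ x₂ : Vec m) (y₁ y₂ : Vec n) :
    ‖gradX f x₁ y₁ - gradX f x₂ y₂‖ ^ 2 ≤ ℓ ^ 2 * ‖x₁ - x₂‖ ^ 2 + ℓ ^ 2 * ‖y₁ - y₂‖ ^ 2 := by
  have := h.lipschitz x₁ x₂ y₁ y₂
  nlinarith [sq_nonneg ‖gradY f x₁ y₁ - gradY f x₂ y₂‖]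

lemma IsSmooth.sq_gradY_sub_le (h : IsSmooth f ℓ) (x₁ x₂ : Vec m) (y₁ y₂ : Vec n) :
    ‖gradY f x₁ y₁ - gradY f x₂ y₂‖ ^ 2 ≤ ℓ ^ 2 * ‖x₁ - x₂‖ ^ 2 + ℓ ^ 2 * ‖y₁ - y₂‖ ^ 2 := by
  have := h.lipschitz x₁ x₂ y₁ y₂
  nlinarith [sq_nonneg ‖gradX f x₁ y₁ - gradX f x₂ y₂‖]

lemma IsSmooth.continuous_gradX (h : IsSmooth f ℓ) (hℓ : 0 < ℓ) :
    Continuous fun p : Vec m × Vec n => gradX f p.1 p.2 := by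
  refine (LipschitzWith.of_dist_le_mul (K := (2 * ℓ).toNNReal) fun p q => ?_).continuous
  rw [dist_eq_norm, dist_eq_norm, Prod.norm_def, Real.coe_toNNReal _ (by positivity)]
  have h1 := h.gradX_lipschitz_left hℓ p.1 q.1 p.2
  have h2 := h.gradX_lipschitz_right hℓ q.1 p.2 q.2
  have h3 := norm_sub_le_norm_sub_add_norm_sub (gradX f p.1 p.2) (gradX f q.1 p.2) (gradX f q.1 q.2)
  have h4 := mul_le_mul_of_nonneg_left (le_max_left ‖(p - q).1‖ ‖(p - q).2‖) hℓ.le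
  have h5 := mul_le_mul_of_nonneg_left (le_max_right ‖(p - q).1‖ ‖(p - q).2‖) hℓ.le
  simp only [Prod.fst_sub, Prod.snd_sub] at *
  linarith

lemma IsSmooth.continuous_gradY (h : IsSmooth f ℓ) (hℓ : 0 < ℓ) :
    Continuous fun p : Vec m × Vec n => gradY f p.1 p.2 := by
  refine (LipschitzWith.of_dist_le_mul (K := (2 * ℓ).toNNReal) fun p q => ?_).continuous
  rw [dist_eq_norm, dist_eq_norm, Prod.norm_def, Real.coe_toNNReal _ (by positivity)]
  have h1 := h.gradY_lipschitz_left hℓ p.1 q.1 p.2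
  have h2 := h.gradY_lipschitz_right hℓ q.1 p.2 q.2
  have h3 := norm_sub_le_norm_sub_add_norm_sub (gradY f p.1 p.2) (gradY f q.1 p.2) (gradY f q.1 q.2)
  have h4 := mul_le_mul_of_nonneg_left (le_max_left ‖(p - q).1‖ ‖(p - q).2‖) hℓ.le
  have h5 := mul_le_mul_of_nonneg_left (le_max_right ‖(p - q).1‖ ‖(p - q).2‖) hℓ.le
  simp only [Prod.fst_sub, Prod.snd_sub] at *
  linarith

/-- Strong monotonicity of `-∇_y f(x, ·)`. -/
lemma IsStronglyConcave.inner_gradY_sub_le (h : IsStronglyConcave f μ) (x : Vec m) (y₁ y₂ : Vec n) :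
    inner ℝ (gradY f x y₁ - gradY f x y₂) (y₁ - y₂) ≤ -μ * ‖y₁ - y₂‖ ^ 2 := by
  have h1 := h x y₁ y₂
  have h2 := h x y₂ y₁
  rw [norm_sub_rev y₂ y₁] at h2
  rw [← neg_sub y₁ y₂, inner_neg_right] at h1
  rw [inner_sub_left]
  linarith

/-- With at least one dual variable, the condition number is at least one. -/
lemma le_of_isSmooth_of_isStronglyConcave (hn : 0 < n) (hℓ : 0 < ℓ) (hs : IsSmooth f ℓ)
    (hc : IsStronglyConcave f μ) : μ ≤ ℓ := by
  let y : Vec n := EuclideanSpace.single ⟨0, hn⟩ 1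
  have hy : ‖y‖ = 1 := by simp [y]
  have h1 := hc.inner_gradY_sub_le 0 y 0
  have h2 := hs.gradY_lipschitz_right hℓ 0 y 0
  have h3 := neg_le_of_abs_le (abs_real_inner_le_norm (gradY f 0 y - gradY f 0 0) (y - 0))
  simp only [sub_zero, hy] at h1 h2 h3
  linarith

/-- Strong concavity traps the superlevel set through `0` in the ball of radius `2‖∇_y f(x, 0)‖ /
μ`, and continuity on this bounded set does the rest. -/
lemma exists_isMax (hμ : 0 < μ) (hs : IsSmooth f ℓ) (hc : IsStronglyConcave f μ) (x : Vec m) :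
    ∃ y : Vec n, ∀ y', f x y' ≤ f x y := by
  have hcont : Continuous (f x) := by
    have := hs.differentiable.continuous.comp (Continuous.prodMk_right x)
    exact this
  refine hcont.exists_forall_ge_of_isBounded 0 ?_
  refine (Metric.isBounded_closedBall (x := (0 : Vec n))
    (r := 2 * ‖gradY f x 0‖ / μ)).subset fun y hy => ?_
  have h1 : f x 0 ≤ f x y := hy
  have h2 := hc x 0 y
  have h3 := real_inner_le_norm (gradY f x 0) y
  simp only [sub_zero, zero_sub, norm_neg] at h2
  rw [mem_closedBall_zero_iff, le_div_iff₀ hμ]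
  rcases (norm_nonneg y).eq_or_lt with h0 | h0
  · rw [← h0]; simp
  · nlinarith

lemma le_argmaxY (hμ : 0 < μ) (hs : IsSmooth f ℓ) (hc : IsStronglyConcave f μ) (x : Vec m)
    (y : Vec n) : f x y ≤ f x (argmaxY f x) :=
  Classical.epsilon_spec (exists_isMax hμ hs hc x) y

lemma primal_eq (hμ : 0 < μ) (hs : IsSmooth f ℓ) (hc : IsStronglyConcave f μ) (x : Vec m) :
    primal f x = f x (argmaxY f x) :=
  le_antisymm (ciSup_le fun y => le_argmaxY hμ hs hc x y)
    (le_ciSup (f := f x) ⟨_, by rintro _ ⟨y, rfl⟩; exact le_argmaxY hμ hs hc x y⟩ _)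

lemma gradY_argmaxY (hμ : 0 < μ) (hs : IsSmooth f ℓ) (hc : IsStronglyConcave f μ) (x : Vec m) :
    gradY f x (argmaxY f x) = 0 := by
  have h : IsLocalMax (f x) (argmaxY f x) :=
    Filter.Eventually.of_forall fun y => le_argmaxY hμ hs hc x y
  have h1 := h.hasFDerivAt_eq_zero (hs.hasGradientAt_gradY x (argmaxY f x)).hasFDerivAt
  simpa using h1

lemma inner_gradY_sub_argmaxY_le (hμ : 0 < μ) (hs : IsSmooth f ℓ) (hc : IsStronglyConcave f μ)
    (x : Vec m) (y : Vec n) :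
    inner ℝ (gradY f x y) (y - argmaxY f x) ≤ -μ * ‖y - argmaxY f x‖ ^ 2 := by
  simpa [gradY_argmaxY hμ hs hc x] using hc.inner_gradY_sub_le x y (argmaxY f x)

/-- Strong monotonicity at `x₂`, tested at `y*(x₁)`: the gradient there vanishes for `x₁`, so for
`x₂` it is at most `ℓ‖x₁ - x₂‖`. -/
lemma argmaxY_lipschitz (hℓ : 0 < ℓ) (hμ : 0 < μ) (hκ : κ = ℓ / μ) (hs : IsSmooth f ℓ)
    (hc : IsStronglyConcave f μ) (x₁ x₂ : Vec m) :
    ‖argmaxY f x₁ - argmaxY f x₂‖ ≤ κ * ‖x₁ - x₂‖ := by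
  have h1 := inner_gradY_sub_argmaxY_le hμ hs hc x₂ (argmaxY f x₁)
  have h2 := hs.gradY_lipschitz_left hℓ x₁ x₂ (argmaxY f x₁)
  rw [gradY_argmaxY hμ hs hc, zero_sub, norm_neg] at h2
  have h3 := neg_le_of_abs_le (abs_real_inner_le_norm (gradY f x₂ (argmaxY f x₁))
    (argmaxY f x₁ - argmaxY f x₂))
  rw [hκ, div_mul_eq_mul_div, le_div_iff₀ hμ]
  rcases (norm_nonneg (argmaxY f x₁ - argmaxY f x₂)).eq_or_lt with h0 | h0
  · rw [← h0]; simp only [zero_mul]; positivity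
  · nlinarith

/-- Danskin's theorem for the primal function, in quantitative form: upper bound. -/
lemma primal_le (hℓ : 0 < ℓ) (hμ : 0 < μ) (hκ : κ = ℓ / μ) (hs : IsSmooth f ℓ)
    (hc : IsStronglyConcave f μ) (x z : Vec m) :
    primal f z ≤ primal f x + inner ℝ (gradX f x (argmaxY f x)) (z - x)
      + (κ + 1 / 2) * ℓ * ‖z - x‖ ^ 2 := by
  -- The dual variable is frozen at `y*(z)`, which is exact at `z` and suboptimal at `x`; exchanging
  -- it for `y*(x)` in the gradient costs the extra `κℓ`.
  have h1 := le_add_inner_add_of_gradient_lipschitz (L := ℓ) (x := x)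
    (fun z' => hs.hasGradientAt_gradX z' (argmaxY f z))
    (fun z' => hs.gradX_lipschitz_left hℓ z' x _) z
  have h2 := le_argmaxY hμ hs hc x (argmaxY f z)
  rw [← primal_eq hμ hs hc] at h1 h2
  have h3 := real_inner_le_norm (gradX f x (argmaxY f z) - gradX f x (argmaxY f x)) (z - x)
  have h4 := hs.gradX_lipschitz_right hℓ x (argmaxY f z) (argmaxY f x)
  have h5 := argmaxY_lipschitz hℓ hμ hκ hs hc z x
  rw [inner_sub_left] at h3
  have h6 := mul_le_mul_of_nonneg_right
    (h4.trans (mul_le_mul_of_nonneg_left h5 hℓ.le)) (norm_nonneg (z - x))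
  linarith

/-- Here the dual variable is frozen at `y*(x)`, so the slice `f(·, y*(x))` minorizes the primal
function and touches it at `x`. -/
lemma primal_ge (hℓ : 0 < ℓ) (hμ : 0 < μ) (hs : IsSmooth f ℓ)
    (hc : IsStronglyConcave f μ) (x z : Vec m) :
    primal f x + inner ℝ (gradX f x (argmaxY f x)) (z - x) - ℓ / 2 * ‖z - x‖ ^ 2 ≤ primal f z := by
  have h1 := le_add_inner_add_of_gradient_lipschitz (L := ℓ) (x := x)
    (F := fun z' => -f z' (argmaxY f x)) (G := fun z' => -gradX f z' (argmaxY f x))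
    (fun z' => by
      have := (hs.hasGradientAt_gradX z' (argmaxY f x)).hasFDerivAt.neg
      rw [← map_neg] at this
      exact hasGradientAt_iff_hasFDerivAt.2 this)
    (fun z' => by
      rw [← neg_sub', norm_neg]
      exact hs.gradX_lipschitz_left hℓ z' x _) z
  have h2 := le_argmaxY hμ hs hc z (argmaxY f x)
  rw [← primal_eq hμ hs hc] at h1 h2
  rw [inner_neg_left] at h1
  linarith

/-- The two one-sided bounds squeeze the first-order remainder to `O(‖z - x‖²)`; neither an implicit
function theorem nor second derivatives are needed. -/
lemma hasGradientAt_primal (hℓ : 0 < ℓ) (hμ : 0 < μ) (hκ : κ = ℓ / μ) (hs : IsSmooth f ℓ)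
    (hc : IsStronglyConcave f μ) (x : Vec m) :
    HasGradientAt (primal f) (gradX f x (argmaxY f x)) x := by
  have hκ0 : 0 < κ := hκ ▸ div_pos hℓ hμ
  rw [hasGradientAt_iff_isLittleO]
  have hO : (fun z => primal f z - primal f x - inner ℝ (gradX f x (argmaxY f x)) (z - x))
      =O[nhds x] fun z => ‖z - x‖ ^ 2 := by
    refine Asymptotics.IsBigO.of_bound ((κ + 1 / 2) * ℓ) (Filter.Eventually.of_forall fun z => ?_)
    have h1 := primal_le hℓ hμ hκ hs hc x z
    have h2 := primal_ge hℓ hμ hs hc x z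
    rw [Real.norm_eq_abs, Real.norm_of_nonneg (by positivity), abs_le]
    have h3 : 0 ≤ κ * ℓ * ‖z - x‖ ^ 2 := by positivity
    constructor <;> nlinarith
  refine hO.trans_isLittleO ?_
  have h4 : Filter.Tendsto (fun z : Vec m => ‖z - x‖) (nhds x) (nhds 0) := by
    have : Continuous fun z : Vec m => ‖z - x‖ := by fun_prop
    simpa using this.tendsto x
  have h5 : (fun z : Vec m => ‖z - x‖ ^ 2) =o[nhds x] fun z => ‖z - x‖ := by
    simp_rw [pow_two]
    simpa using ((Asymptotics.isLittleO_one_iff ℝ).2 h4).mul_isBigO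
      (Asymptotics.isBigO_refl (fun z : Vec m => ‖z - x‖) (nhds x))
  exact h5.of_norm_right

lemma gradient_primal (hℓ : 0 < ℓ) (hμ : 0 < μ) (hκ : κ = ℓ / μ) (hs : IsSmooth f ℓ)
    (hc : IsStronglyConcave f μ) (x : Vec m) :
    gradient (primal f) x = gradX f x (argmaxY f x) :=
  (hasGradientAt_primal hℓ hμ hκ hs hc x).gradient

lemma continuous_argmaxY (hℓ : 0 < ℓ) (hμ : 0 < μ) (hs : IsSmooth f ℓ)
    (hc : IsStronglyConcave f μ) : Continuous (argmaxY f) :=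
  (LipschitzWith.of_dist_le_mul (K := (ℓ / μ).toNNReal) fun p q => by
    rw [dist_eq_norm, dist_eq_norm, Real.coe_toNNReal _ (by positivity)]
    exact argmaxY_lipschitz hℓ hμ rfl hs hc p q).continuous

lemma continuous_gradient_primal (hℓ : 0 < ℓ) (hμ : 0 < μ) (hs : IsSmooth f ℓ)
    (hc : IsStronglyConcave f μ) : Continuous (gradient (primal f)) := by
  have : gradient (primal f) = fun x => gradX f x (argmaxY f x) :=
    funext fun x => gradient_primal hℓ hμ rfl hs hc x
  rw [this]
  exact (hs.continuous_gradX hℓ).comp (continuous_id.prodMk (continuous_argmaxY hℓ hμ hs hc))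

lemma sq_argmaxY_sub_le (hℓ : 0 < ℓ) (hμ : 0 < μ) (hκ : κ = ℓ / μ) (hs : IsSmooth f ℓ)
    (hc : IsStronglyConcave f μ) (x z : Vec m) :
    ‖argmaxY f x - argmaxY f z‖ ^ 2 ≤ κ ^ 2 * ‖x - z‖ ^ 2 := by
  rw [← mul_pow]
  exact pow_le_pow_left₀ (norm_nonneg _) (argmaxY_lipschitz hℓ hμ hκ hs hc x z) 2

lemma sq_gradient_primal_sub_le (hℓ : 0 < ℓ) (hμ : 0 < μ) (hκ : κ = ℓ / μ) (hκ1 : 1 ≤ κ)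
    (hs : IsSmooth f ℓ) (hc : IsStronglyConcave f μ) (x z : Vec m) :
    ‖gradient (primal f) x - gradient (primal f) z‖ ^ 2 ≤ 2 * κ ^ 2 * ℓ ^ 2 * ‖x - z‖ ^ 2 := by
  rw [gradient_primal hℓ hμ hκ hs hc, gradient_primal hℓ hμ hκ hs hc]
  have h1 := hs.sq_gradX_sub_le x z (argmaxY f x) (argmaxY f z)
  have h2 := mul_le_mul_of_nonneg_left (sq_argmaxY_sub_le hℓ hμ hκ hs hc x z) (sq_nonneg ℓ)
  have h3 : 1 ≤ κ ^ 2 := one_le_pow₀ hκ1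
  have h4 := mul_le_mul_of_nonneg_right h3 (by positivity : 0 ≤ ℓ ^ 2 * ‖x - z‖ ^ 2)
  nlinarith

lemma primal_le_add (hℓ : 0 < ℓ) (hμ : 0 < μ) (hκ : κ = ℓ / μ) (hκ1 : 1 ≤ κ) (hs : IsSmooth f ℓ)
    (hc : IsStronglyConcave f μ) (x d : Vec m) :
    primal f (x + d) ≤ primal f x + inner ℝ (gradient (primal f) x) d
      + 3 / 2 * κ * ℓ * ‖d‖ ^ 2 := by
  have h := primal_le hℓ hμ hκ hs hc x (x + d)
  rw [gradient_primal hℓ hμ hκ hs hc]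
  rw [add_sub_cancel_left] at h
  have h2 : 0 ≤ (κ - 1) * (ℓ * ‖d‖ ^ 2) := mul_nonneg (by linarith) (by positivity)
  linarith

/-- A gradient step of length `1/(3κℓ)`, which minimizes the quadratic upper bound, cannot go below
the infimum. This bounds the initial gradients in OGDA. -/
lemma sq_gradient_primal_le (hℓ : 0 < ℓ) (hμ : 0 < μ) (hκ : κ = ℓ / μ) (hκ1 : 1 ≤ κ)
    (hs : IsSmooth f ℓ) (hc : IsStronglyConcave f μ) (hb : BddBelow (Set.range (primal f)))
    (x : Vec m) :
    ‖gradient (primal f) x‖ ^ 2 ≤ 6 * κ * ℓ * (primal f x - ⨅ z, primal f z) := by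
  have hκℓ : 0 < κ * ℓ := by positivity
  set t : ℝ := 1 / (3 * κ * ℓ) with ht
  have h1 := primal_le_add hℓ hμ hκ hκ1 hs hc x (-(t • gradient (primal f) x))
  have h2 := ciInf_le hb (x + -(t • gradient (primal f) x))
  rw [inner_neg_right, inner_smul_right, real_inner_self_eq_norm_sq, norm_neg, norm_smul, mul_pow,
    Real.norm_eq_abs, sq_abs] at h1
  have h3 : 3 / 2 * κ * ℓ * (t ^ 2 * ‖gradient (primal f) x‖ ^ 2)
      = t / 2 * ‖gradient (primal f) x‖ ^ 2 := by
    rw [ht]; field_simp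
  have h4 : t / 2 * ‖gradient (primal f) x‖ ^ 2 ≤ primal f x - ⨅ z, primal f z := by linarith
  have h5 := mul_le_mul_of_nonneg_left h4 (by positivity : 0 ≤ 6 * κ * ℓ)
  have h6 : 6 * κ * ℓ * (t / 2 * ‖gradient (primal f) x‖ ^ 2) = ‖gradient (primal f) x‖ ^ 2 := by
    rw [ht]; field_simp; norm_num
  linarith

end Objective

/-! ### Hilbert space identities. -/

section Norms

variable {E : Type*} [NormedAddCommGroup E] [InnerProductSpace ℝ E]

omit [InnerProductSpace ℝ E] in
lemma sq_norm_add_le_mul (a b : E) {β : ℝ} (hβ : 0 < β) :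
    ‖a + b‖ ^ 2 ≤ (1 + β) * ‖a‖ ^ 2 + (1 + 1 / β) * ‖b‖ ^ 2 := by
  have h1 := norm_add_le a b
  have h2 : ‖a + b‖ ^ 2 ≤ (‖a‖ + ‖b‖) ^ 2 := pow_le_pow_left₀ (norm_nonneg _) h1 2
  have h3 : (1 + β) * ‖a‖ ^ 2 + (1 + 1 / β) * ‖b‖ ^ 2 - (‖a‖ + ‖b‖) ^ 2
      = (β * ‖a‖ - ‖b‖) ^ 2 / β := by field_simp; ring
  have h4 : 0 ≤ (β * ‖a‖ - ‖b‖) ^ 2 / β := by positivity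
  linarith

lemma sq_norm_add_eq (a b : E) : ‖a + b‖ ^ 2 = ‖a‖ ^ 2 + 2 * inner ℝ a b + ‖b‖ ^ 2 :=
  norm_add_sq_real a b

lemma sq_norm_smul (r : ℝ) (a : E) : ‖r • a‖ ^ 2 = r ^ 2 * ‖a‖ ^ 2 := by
  rw [norm_smul, mul_pow, Real.norm_eq_abs, sq_abs]

/-- The basic identity behind extragradient and optimistic steps: the base point `y` moves by
`η g`, the extrapolated point being `y + η b`. -/
lemma sq_norm_extragradient (y u b g : E) (η : ℝ) :
    ‖y + η • g - u‖ ^ 2 = ‖y - u‖ ^ 2 + 2 * η * inner ℝ g (y + η • b - u)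
      + η ^ 2 * ‖g - b‖ ^ 2 - η ^ 2 * ‖b‖ ^ 2 := by
  have h1 : y + η • g - u = (y - u) + η • g := by abel
  have h2 : y + η • b - u = (y - u) + η • b := by abel
  rw [h1, h2, norm_add_sq_real, norm_sub_sq_real g b, sq_norm_smul, inner_add_right,
    inner_smul_right, inner_smul_right, real_inner_comm g (y - u)]
  ring

end Norms

/-- `f` is `ℓ`-smooth and `μ`-strongly concave in `y`, with condition number `κ ≥ 1`. -/
structure IsProblem {m n : ℕ} (f : Vec m → Vec n → ℝ) (ℓ μ κ : ℝ) : Prop where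
  ℓ_pos : 0 < ℓ
  μ_pos : 0 < μ
  κ_eq : κ = ℓ / μ
  one_le_κ : 1 ≤ κ
  smooth : IsSmooth f ℓ
  conc : IsStronglyConcave f μ

/-! ### The one-step inequality common to both methods. -/

section Step

variable {m n : ℕ} {f : Vec m → Vec n → ℝ} {ℓ μ κ c k ηx ηy : ℝ}

/-- Stepsize conventions shared by both methods. -/
structure IsStep (ℓ κ c k ηx ηy : ℝ) : Prop where
  ℓ_pos : 0 < ℓ
  one_le_κ : 1 ≤ κ
  c_pos : 0 < c
  c_le : c ≤ 1 / 50
  four_le : 4 ≤ k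
  le_six : k ≤ 6
  ηx_eq : ηx = c / (κ ^ 2 * ℓ)
  ηy_eq : ηy = 1 / (k * ℓ)

/-- The weight of the dual tracking error in the potential. -/
def dualWeight (ℓ κ k ηx : ℝ) : ℝ := 2 / 7 * k * κ * ℓ ^ 2 * ηx

namespace IsStep

variable (h : IsStep ℓ κ c k ηx ηy)
include h

lemma κ_pos : 0 < κ := one_pos.trans_le h.one_le_κ

lemma k_pos : 0 < k := by linarith [h.four_le]

lemma ηx_pos : 0 < ηx := by
  have := h.ℓ_pos; have := h.κ_pos; have := h.c_pos
  rw [h.ηx_eq]; positivity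

lemma ηy_pos : 0 < ηy := by
  have := h.ℓ_pos; have := h.k_pos
  rw [h.ηy_eq]; positivity

lemma dualWeight_pos : 0 < dualWeight ℓ κ k ηx := by
  have := h.ℓ_pos; have := h.κ_pos; have := h.ηx_pos; have := h.k_pos
  unfold dualWeight; positivity

lemma sq_c_le : c ^ 2 ≤ 1 / 2500 := by nlinarith [h.c_pos, h.c_le]

lemma one_le_sq_κ : 1 ≤ κ ^ 2 := one_le_pow₀ h.one_le_κ

/-- The scale at which dual gradients and dual noise enter the potential. Its factor `κ` is what the
dual batch size has to offset. -/
lemma dualWeight_mul_sq : dualWeight ℓ κ k ηx * ηy ^ 2 = ηx * (2 / 7 * (κ / k)) := by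
  have := h.ℓ_pos.ne'; have := h.k_pos.ne'
  rw [dualWeight, h.ηy_eq]; field_simp

lemma sq_mul_sq_le : κ ^ 2 * ℓ ^ 2 * ηx ^ 2 ≤ 1 / 2500 := by
  have : κ ^ 2 * ℓ ^ 2 * ηx ^ 2 = c ^ 2 / κ ^ 2 := by
    have := h.ℓ_pos.ne'; have := h.κ_pos.ne'
    rw [h.ηx_eq]; field_simp
  rw [this]
  exact (div_le_self (sq_nonneg c) h.one_le_sq_κ).trans h.sq_c_le

lemma sq_ℓ_mul_sq_le : ℓ ^ 2 * ηx ^ 2 ≤ 1 / 2500 := by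
  have := mul_le_mul_of_nonneg_right h.one_le_sq_κ (by positivity : 0 ≤ ℓ ^ 2 * ηx ^ 2)
  linarith [h.sq_mul_sq_le]

lemma descent_coeff_le : 3 / 2 * κ * ℓ * ηx ^ 2 ≤ 3 / 100 * ηx := by
  have h1 : κ * ℓ * ηx ≤ 1 / 50 := by
    have : κ * ℓ * ηx = c / κ := by
      have := h.ℓ_pos.ne'; have := h.κ_pos.ne'
      rw [h.ηx_eq]; field_simp
    rw [this]
    exact (div_le_self h.c_pos.le h.one_le_κ).trans h.c_le
  nlinarith [h.ηx_pos]

/-- The price of the motion of `y*(x)`, with the Young factor `1 + 16kκ`. The weight, this factor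
and the Lipschitz constant of `y*` together give `κ⁴`, which `ηx²` cancels exactly. -/
lemma dualWeight_drift_le : dualWeight ℓ κ k ηx * ((1 + 16 * k * κ) * (κ ^ 2 * ηx ^ 2))
    ≤ 7 / 100 * ηx := by
  have h0 := h.dualWeight_pos; have h6 := h.le_six; have hk := h.k_pos; have hη := h.ηx_pos
  have hκ := h.κ_pos
  have h1 : 1 + 16 * k * κ ≤ 97 * κ := by nlinarith [h.one_le_κ]
  have h2 : dualWeight ℓ κ k ηx * (97 * κ * (κ ^ 2 * ηx ^ 2)) = 194 / 7 * k * c ^ 2 * ηx := by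
    have := h.ℓ_pos.ne'
    rw [dualWeight, h.ηx_eq]; field_simp; ring
  have h3 : dualWeight ℓ κ k ηx * ((1 + 16 * k * κ) * (κ ^ 2 * ηx ^ 2))
      ≤ dualWeight ℓ κ k ηx * (97 * κ * (κ ^ 2 * ηx ^ 2)) := by
    gcongr
  have h4 : 194 / 7 * k * c ^ 2 ≤ 194 / 7 * 6 * (1 / 2500) := by
    have := h.sq_c_le
    gcongr
  have h5 := mul_le_mul_of_nonneg_right h4 hη.le
  linarith

end IsStep

/-- Polarization turns `-⟨∇Φ(x), v⟩` into half of `‖∇Φ(x) - v‖² - ‖∇Φ(x)‖² - ‖v‖²`. Since both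
gradients are values of `∇ₓf`, the first square is bounded by the primal extrapolation and the dual
tracking error. -/
lemma IsProblem.primal_step_le (hf : IsProblem f ℓ μ κ) (h : IsStep ℓ κ c k ηx ηy)
    (x a : Vec m) (y : Vec n) (v e : Vec m) (hv : v = gradX f (x - ηx • a) y) :
    primal f (x - ηx • (v + e)) ≤ primal f x
      + ηx * (-(1 / 2) * ‖gradient (primal f) x‖ ^ 2 - 1 / 2 * ‖v‖ ^ 2 + 1 / 5000 * ‖a‖ ^ 2
        + 1 / 2 * ℓ ^ 2 * ‖y - argmaxY f x‖ ^ 2)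
      - ηx * inner ℝ (gradient (primal f) x) e + 3 / 100 * ηx * ‖v + e‖ ^ 2 := by
  obtain ⟨hℓ, hμ, hκ, hκ1, hs, hcc⟩ := hf
  have F1 := primal_le_add hℓ hμ hκ hκ1 hs hcc x (-(ηx • (v + e)))
  rw [← sub_eq_add_neg, inner_neg_right, inner_smul_right, norm_neg, sq_norm_smul,
    inner_add_right] at F1
  have h0 := mul_le_mul_of_nonneg_right h.descent_coeff_le (sq_nonneg ‖v + e‖)
  have h1 := hs.sq_gradX_sub_le x (x - ηx • a) (argmaxY f x) y
  rw [← hv, ← gradient_primal hℓ hμ hκ hs hcc, sub_sub_cancel, sq_norm_smul,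
    norm_sub_rev (argmaxY f x), norm_sub_sq_real] at h1
  have h2 := mul_le_mul_of_nonneg_right h.sq_ℓ_mul_sq_le (sq_nonneg ‖a‖)
  have h3 := mul_le_mul_of_nonneg_left h1 h.ηx_pos.le
  have h4 := mul_le_mul_of_nonneg_left h2 h.ηx_pos.le
  linarith

/-- The weight satisfies `W ηy μ = (2/7) ℓ² ηx`, so strong monotonicity yields `4/7` of `ηx ℓ²`
times the squared error. One sixteenth of it is spent on evaluating the gradient at `x - ηx a`
instead of `x`, leaving `15/28`. -/
lemma IsProblem.inner_gradY_le (hf : IsProblem f ℓ μ κ) (h : IsStep ℓ κ c k ηx ηy)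
    (x a : Vec m) (y : Vec n) :
    2 * dualWeight ℓ κ k ηx * ηy * inner ℝ (gradY f (x - ηx • a) y) (y - argmaxY f x)
      ≤ ηx * (-(15 / 28) * ℓ ^ 2 * ‖y - argmaxY f x‖ ^ 2 + 16 / 17500 * ‖a‖ ^ 2) := by
  have hκ0 := h.κ_pos; have hηx := h.ηx_pos; have hηy := h.ηy_pos; have hW := h.dualWeight_pos
  have hk := h.k_pos
  obtain ⟨hℓ, hμ, hκ, hκ1, hs, hcc⟩ := hf
  have hμℓ : μ = ℓ / κ := by rw [hκ]; field_simp
  have hWμ : dualWeight ℓ κ k ηx * (ηy * μ) = 2 / 7 * ℓ ^ 2 * ηx := by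
    rw [dualWeight, h.ηy_eq, hμℓ]; field_simp
  have h1 := inner_gradY_sub_argmaxY_le hμ hs hcc x y
  have h2 := hs.gradY_lipschitz_left hℓ (x - ηx • a) x y
  set w := gradY f (x - ηx • a) y
  set d := y - argmaxY f x
  have h3 := real_inner_le_norm (w - gradY f x y) d
  rw [sub_sub_cancel_left, norm_neg, norm_smul, Real.norm_of_nonneg hηx.le] at h2
  rw [inner_sub_left] at h3
  have h4 := mul_le_mul_of_nonneg_right h2 (norm_nonneg d)
  have h5 : ℓ * (ηx * ‖a‖) * ‖d‖ ≤ μ / 16 * ‖d‖ ^ 2 + 4 * κ * ℓ * ηx ^ 2 * ‖a‖ ^ 2 := by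
    have h6 : μ / 16 * ‖d‖ ^ 2 + 4 * κ * ℓ * ηx ^ 2 * ‖a‖ ^ 2 - ℓ * (ηx * ‖a‖) * ‖d‖
        = ℓ / κ * (1 / 4 * ‖d‖ - 2 * κ * ηx * ‖a‖) ^ 2 := by
      rw [hμℓ]; field_simp; ring
    have : 0 ≤ ℓ / κ * (1 / 4 * ‖d‖ - 2 * κ * ηx * ‖a‖) ^ 2 := by positivity
    linarith
  have h7 : inner ℝ w d
      ≤ -(15 / 16) * μ * ‖d‖ ^ 2 + 4 * κ * ℓ * ηx ^ 2 * ‖a‖ ^ 2 := by linarith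
  have h8 := mul_le_mul_of_nonneg_left h7 (by positivity : 0 ≤ 2 * dualWeight ℓ κ k ηx * ηy)
  have h9 : 2 * dualWeight ℓ κ k ηx * ηy * (4 * κ * ℓ * ηx ^ 2 * ‖a‖ ^ 2)
      = 16 / 7 * ηx * ‖a‖ ^ 2 * (κ ^ 2 * ℓ ^ 2 * ηx ^ 2) := by
    rw [dualWeight, h.ηy_eq]; field_simp; ring
  have h10 := mul_le_mul_of_nonneg_left h.sq_mul_sq_le
    (by positivity : 0 ≤ 16 / 7 * ηx * ‖a‖ ^ 2)
  have h11 : 2 * dualWeight ℓ κ k ηx * ηy * (-(15 / 16) * μ * ‖d‖ ^ 2)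
      = -(15 / 28) * ℓ ^ 2 * ηx * ‖d‖ ^ 2 := by
    linear_combination (-(15 / 8) * ‖d‖ ^ 2) * hWμ
  linarith

/-- The extragradient identity is used with target `y*(x)`, and the target is then shifted to
`y*(x')` by Young's inequality. The coefficient `-1/2` is the one that cancels the tracking error in
`IsProblem.primal_step_le`. -/
lemma IsProblem.dual_step_le (hf : IsProblem f ℓ μ κ) (h : IsStep ℓ κ c k ηx ηy)
    (x a x' : Vec m) (y b e : Vec n) (w : Vec n)
    (hw : w = gradY f (x - ηx • a) (y + ηy • b)) :
    dualWeight ℓ κ k ηx * ‖y + ηy • (w + e) - argmaxY f x'‖ ^ 2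
      ≤ dualWeight ℓ κ k ηx * ‖y - argmaxY f x‖ ^ 2
        + ηx * (-(1 / 2) * ℓ ^ 2 * ‖y + ηy • b - argmaxY f x‖ ^ 2 + 1 / 1000 * ‖a‖ ^ 2
          + 2 / 7 * (κ / k) * (65 / 64 * ‖w - b‖ ^ 2 - 63 / 64 * ‖b‖ ^ 2 + 65 / 64 * ‖e‖ ^ 2))
        + inner ℝ (((1 + 1 / (16 * k * κ)) * dualWeight ℓ κ k ηx)
            • ((2 * ηy) • (y + ηy • b - argmaxY f x) + (2 * ηy ^ 2) • (w - b))) e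
        + dualWeight ℓ κ k ηx * ((1 + 16 * k * κ) * (κ ^ 2 * ‖x - x'‖ ^ 2)) := by
  have hκ0 := h.κ_pos; have hηx := h.ηx_pos; have hηy := h.ηy_pos; have hW := h.dualWeight_pos
  have hk := h.k_pos
  have F4 := hf.inner_gradY_le h x a (y + ηy • b)
  have hY := h.dualWeight_mul_sq
  obtain ⟨hℓ, hμ, hκ, hκ1, hs, hcc⟩ := hf
  have hβW : 1 / (16 * k * κ) * dualWeight ℓ κ k ηx = 1 / 56 * ℓ ^ 2 * ηx := by
    rw [dualWeight]; field_simp; norm_num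
  rw [← hw] at F4
  set u := argmaxY f x with hu
  set yh := y + ηy • b with hyh
  have F3 := sq_norm_extragradient y u b (w + e) ηy
  rw [← hyh, show w + e - b = (w - b) + e by abel, sq_norm_add_eq (w - b) e, inner_add_left,
    real_inner_comm (yh - u) e] at F3
  have F5 : ‖y - u‖ ^ 2 ≤ 2 * ‖yh - u‖ ^ 2 + 2 * (ηy ^ 2 * ‖b‖ ^ 2) := by
    have h := sq_norm_add_le_mul (yh - u) (-(ηy • b)) one_pos
    rw [norm_neg, sq_norm_smul, show yh - u + -(ηy • b) = y - u by rw [hyh]; abel] at h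
    linarith
  -- The Young parameter is small enough that inflating `‖y - y*(x)‖²`, rewritten by `F5` at the
  -- extrapolated point, costs only `1/28` of the available `15/28`; the `‖b‖²` part of `F5` turns
  -- `1 + β` into `1 - β ≥ 63/64`.
  have hβ0 : 0 < 1 / (16 * k * κ) := by positivity
  have hβ1 : 1 / (16 * k * κ) ≤ 1 / 64 := by
    refine one_div_le_one_div_of_le (by norm_num) ?_
    nlinarith [h.four_le]
  have F6 := sq_norm_add_le_mul (y + ηy • (w + e) - u) (u - argmaxY f x') hβ0
  rw [sub_add_sub_cancel, one_div_one_div] at F6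
  have F7 := mul_le_mul_of_nonneg_left (sq_argmaxY_sub_le hℓ hμ hκ hs hcc x x')
    (by positivity : 0 ≤ dualWeight ℓ κ k ηx * (1 + 16 * k * κ))
  rw [← hu] at F7
  have F6' := mul_le_mul_of_nonneg_left F6 hW.le
  set J := inner ℝ (dualWeight ℓ κ k ηx • ((2 * ηy) • (yh - u) + (2 * ηy ^ 2) • (w - b))) e with hJ
  have hJ' : inner ℝ (((1 + 1 / (16 * k * κ)) * dualWeight ℓ κ k ηx)
      • ((2 * ηy) • (yh - u) + (2 * ηy ^ 2) • (w - b))) e = (1 + 1 / (16 * k * κ)) * J := by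
    rw [mul_smul, real_inner_smul_left]
  have F3' : dualWeight ℓ κ k ηx * ‖y + ηy • (w + e) - u‖ ^ 2
      ≤ dualWeight ℓ κ k ηx * ‖y - u‖ ^ 2
        + ηx * (-(15 / 28) * ℓ ^ 2 * ‖yh - u‖ ^ 2 + 16 / 17500 * ‖a‖ ^ 2)
        + ηx * (2 / 7 * (κ / k)) * (‖w - b‖ ^ 2 - ‖b‖ ^ 2 + ‖e‖ ^ 2) + J := by
    rw [F3, ← hY, hJ, real_inner_smul_left, inner_add_left, real_inner_smul_left,
      real_inner_smul_left]
    linarith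
  rw [hJ']
  have F9 := mul_le_mul_of_nonneg_left F5
    (by positivity : 0 ≤ 1 / (16 * k * κ) * dualWeight ℓ κ k ηx)
  have F9' : 1 / (16 * k * κ) * dualWeight ℓ κ k ηx * (2 * ‖yh - u‖ ^ 2 + 2 * (ηy ^ 2 * ‖b‖ ^ 2))
      = 1 / 28 * ηx * ℓ ^ 2 * ‖yh - u‖ ^ 2
        + 2 * (1 / (16 * k * κ)) * (ηx * (2 / 7 * (κ / k)) * ‖b‖ ^ 2) := by
    rw [← hY]; linear_combination (2 * ‖yh - u‖ ^ 2) * hβW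
  have hYp : 0 ≤ ηx * (2 / 7 * (κ / k)) := by positivity
  rw [show ηx * (-(1 / 2) * ℓ ^ 2 * ‖yh - u‖ ^ 2 + 1 / 1000 * ‖a‖ ^ 2
      + 2 / 7 * (κ / k) * (65 / 64 * ‖w - b‖ ^ 2 - 63 / 64 * ‖b‖ ^ 2 + 65 / 64 * ‖e‖ ^ 2))
      = -(1 / 2) * (ηx * ℓ ^ 2 * ‖yh - u‖ ^ 2) + 1 / 1000 * (ηx * ‖a‖ ^ 2)
      + ηx * (2 / 7 * (κ / k)) * (65 / 64 * ‖w - b‖ ^ 2 - 63 / 64 * ‖b‖ ^ 2 + 65 / 64 * ‖e‖ ^ 2)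
      by ring]
  generalize ηx * (2 / 7 * (κ / k)) = Y at *
  generalize 1 / (16 * k * κ) = β at *
  have F8 := mul_le_mul_of_nonneg_left F3' (by positivity : 0 ≤ 1 + β)
  have G1 := mul_le_mul_of_nonneg_right hβ1 (by positivity : 0 ≤ ηx * ‖a‖ ^ 2)
  have G2a := mul_le_mul_of_nonneg_right hβ1 (by positivity : 0 ≤ Y * ‖b‖ ^ 2)
  have G2b := mul_le_mul_of_nonneg_right hβ1 (by positivity : 0 ≤ Y * ‖w - b‖ ^ 2)
  have G2c := mul_le_mul_of_nonneg_right hβ1 (by positivity : 0 ≤ Y * ‖e‖ ^ 2)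
  have G3 : 0 ≤ β * (ηx * ℓ ^ 2 * ‖yh - u‖ ^ 2) := by positivity
  have G4 : 0 ≤ ηx * ‖a‖ ^ 2 := by positivity
  linarith

/-- One step from the base point `(x, y)`, extrapolated along `(a, b)`, with noisy gradients
`v + ex`, `w + ey` at the extrapolated point. -/
lemma IsProblem.exists_step (hf : IsProblem f ℓ μ κ) (h : IsStep ℓ κ c k ηx ηy)
    (x a : Vec m) (y b : Vec n) (v : Vec m) (w : Vec n)
    (hv : v = gradX f (x - ηx • a) (y + ηy • b)) (hw : w = gradY f (x - ηx • a) (y + ηy • b)) :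
    ∃ (bx : Vec m) (b_y : Vec n), ∀ (ex : Vec m) (ey : Vec n),
      primal f (x - ηx • (v + ex)) + dualWeight ℓ κ k ηx *
        ‖y + ηy • (w + ey) - argmaxY f (x - ηx • (v + ex))‖ ^ 2
      ≤ primal f x + dualWeight ℓ κ k ηx * ‖y - argmaxY f x‖ ^ 2
        + ηx * (-(1 / 2) * ‖gradient (primal f) x‖ ^ 2 - 2 / 5 * ‖v‖ ^ 2 + 3 / 2500 * ‖a‖ ^ 2
          + 2 / 7 * (κ / k) * (65 / 64 * ‖w - b‖ ^ 2 - 63 / 64 * ‖b‖ ^ 2))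
        + inner ℝ bx ex + inner ℝ b_y ey
        + ηx * (1 / 10) * ‖ex‖ ^ 2 + ηx * (2 / 7 * (κ / k) * (65 / 64)) * ‖ey‖ ^ 2 := by
  -- Coefficients of the terms linear in the noise. They do not involve `ex`, `ey`, which is what
  -- makes them vanish in expectation. The `1/5` is twice `3/100 + 7/100`, the curvature and drift
  -- coefficients of `‖v + ex‖²`.
  refine ⟨(-ηx) • gradient (primal f) x + (1 / 5 * ηx) • v,
    ((1 + 1 / (16 * k * κ)) * dualWeight ℓ κ k ηx)
      • ((2 * ηy) • (y + ηy • b - argmaxY f x) + (2 * ηy ^ 2) • (w - b)), fun ex ey => ?_⟩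
  have h1 := hf.primal_step_le h x a (y + ηy • b) v ex hv
  have h2 := hf.dual_step_le h x a (x - ηx • (v + ex)) y b ey w hw
  have h3 := mul_le_mul_of_nonneg_right h.dualWeight_drift_le (sq_nonneg ‖v + ex‖)
  rw [sub_sub_cancel, sq_norm_smul] at h2
  rw [inner_add_left, real_inner_smul_left, real_inner_smul_left]
  rw [sq_norm_add_eq v ex] at h1 h2 h3
  linarith

end Step

/-! ### Mean and variance of minibatch errors. -/

section Noise

variable {m n d M : ℕ} {Ξ Ω : Type*} [MeasurableSpace Ξ] [MeasurableSpace Ω] {P : Measure Ω}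
  {ν : Measure Ξ} {g : Vec m → Vec n → Vec d} {G : Vec m → Vec n → Ξ → Vec d} {σ : ℝ}
  {ξ : Fin M → Ω → Ξ}

/-- The error of the minibatch estimator at the point `p`. -/
def minibatchError (g : Vec m → Vec n → Vec d) (G : Vec m → Vec n → Ξ → Vec d) (ξ : Fin M → Ξ)
    (p : Vec m × Vec n) : Vec d :=
  minibatch G ξ p - g p.1 p.2

omit [MeasurableSpace Ξ] in
lemma add_minibatchError (g : Vec m → Vec n → Vec d) (G : Vec m → Vec n → Ξ → Vec d)
    (ξ : Fin M → Ξ) (p : Vec m × Vec n) : g p.1 p.2 + minibatchError g G ξ p = minibatch G ξ p :=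
  add_sub_cancel _ _

omit [MeasurableSpace Ξ] in
lemma minibatchError_eq (hM : 0 < M) (g : Vec m → Vec n → Vec d) (G : Vec m → Vec n → Ξ → Vec d)
    (ξ : Fin M → Ξ) (p : Vec m × Vec n) :
    minibatchError g G ξ p = (M : ℝ)⁻¹ • ∑ i, (G p.1 p.2 (ξ i) - g p.1 p.2) := by
  have : (M : ℝ) ≠ 0 := by positivity
  rw [minibatchError, minibatch, Finset.sum_sub_distrib, smul_sub, Finset.sum_const,
    Finset.card_univ, Fintype.card_fin, ← Nat.cast_smul_eq_nsmul ℝ, inv_smul_smul₀ this]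

variable [IsProbabilityMeasure P] [IsProbabilityMeasure ν]

lemma IsStochasticOracle.integrable_sub (h : IsStochasticOracle ν g G σ) (x : Vec m) (y : Vec n) :
    Integrable (fun ξ => G x y ξ - g x y) ν :=
  (h.integrable x y).sub (integrable_const _)

lemma IsStochasticOracle.integral_sub (h : IsStochasticOracle ν g G σ) (x : Vec m) (y : Vec n) :
    ∫ ξ, (G x y ξ - g x y) ∂ν = 0 := by
  rw [MeasureTheory.integral_sub (h.integrable x y) (integrable_const _), h.unbiased]
  simp

omit [IsProbabilityMeasure ν] in
lemma IsStochasticOracle.measurable_point (h : IsStochasticOracle ν g G σ) (x : Vec m)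
    (y : Vec n) : Measurable (G x y) :=
  h.measurable.comp (measurable_prodMk_left (x := (x, y)))

omit [IsProbabilityMeasure P] [IsProbabilityMeasure ν] in
lemma MeasurePreserving.integral_comp_of_aestronglyMeasurable {E : Type*} [NormedAddCommGroup E]
    [NormedSpace ℝ E] {X : Ω → Ξ} (hX : MeasurePreserving X P ν) {F : Ξ → E}
    (hF : AEStronglyMeasurable F ν) : ∫ ω, F (X ω) ∂P = ∫ ξ, F ξ ∂ν := by
  rw [← hX.map_eq] at hF ⊢
  exact (integral_map hX.measurable.aemeasurable hF).symm

omit [IsProbabilityMeasure P] in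
lemma IsStochasticOracle.integrable_sub_comp (h : IsStochasticOracle ν g G σ) {X : Ω → Ξ}
    (hX : MeasurePreserving X P ν) (x : Vec m) (y : Vec n) :
    Integrable (fun ω => G x y (X ω) - g x y) P :=
  hX.integrable_comp_of_integrable (h.integrable_sub x y)

omit [IsProbabilityMeasure P] in
lemma IsStochasticOracle.integral_sub_comp (h : IsStochasticOracle ν g G σ) {X : Ω → Ξ}
    (hX : MeasurePreserving X P ν) (x : Vec m) (y : Vec n) :
    ∫ ω, (G x y (X ω) - g x y) ∂P = 0 := by
  rw [MeasurePreserving.integral_comp_of_aestronglyMeasurable hX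
    (F := fun ξ => G x y ξ - g x y) (h.integrable_sub x y).aestronglyMeasurable, h.integral_sub]

omit [IsProbabilityMeasure P] in
lemma IsStochasticOracle.integrable_minibatchError (h : IsStochasticOracle ν g G σ) (hM : 0 < M)
    (hξ : ∀ i, MeasurePreserving (ξ i) P ν) (p : Vec m × Vec n) :
    Integrable (fun ω => minibatchError g G (fun i => ξ i ω) p) P := by
  simp_rw [minibatchError_eq hM]
  exact Integrable.smul (M : ℝ)⁻¹ (integrable_finsetSum Finset.univ fun i _ =>
    h.integrable_sub_comp (hξ i) p.1 p.2)

omit [IsProbabilityMeasure P] in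
lemma IsStochasticOracle.integral_minibatchError (h : IsStochasticOracle ν g G σ) (hM : 0 < M)
    (hξ : ∀ i, MeasurePreserving (ξ i) P ν) (p : Vec m × Vec n) :
    ∫ ω, minibatchError g G (fun i => ξ i ω) p ∂P = 0 := by
  simp_rw [minibatchError_eq hM]
  rw [integral_smul, integral_finsetSum Finset.univ fun i _ =>
    h.integrable_sub_comp (hξ i) p.1 p.2, Finset.sum_eq_zero, smul_zero]
  exact fun i _ => h.integral_sub_comp (hξ i) p.1 p.2

omit [IsProbabilityMeasure P] in
-- The entries of the Gram matrix of the centred samples: off the diagonal, independence factors the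
-- expectation into a product of zero means.
lemma IsStochasticOracle.integrable_inner_and_integral_le (h : IsStochasticOracle ν g G σ)
    (hξ : ∀ i, MeasurePreserving (ξ i) P ν) (hind : iIndepFun ξ P) (p : Vec m × Vec n)
    (i j : Fin M) :
    Integrable (fun ω => inner ℝ (G p.1 p.2 (ξ i ω) - g p.1 p.2) (G p.1 p.2 (ξ j ω) - g p.1 p.2)) P
    ∧ ∫ ω, inner ℝ (G p.1 p.2 (ξ i ω) - g p.1 p.2) (G p.1 p.2 (ξ j ω) - g p.1 p.2) ∂P
      ≤ if i = j then σ ^ 2 else 0 := by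
  have hint : ∀ i, Integrable (fun ω => G p.1 p.2 (ξ i ω) - g p.1 p.2) P := fun i =>
    h.integrable_sub_comp (hξ i) p.1 p.2
  by_cases hij : i = j
  · subst hij
    simp only [real_inner_self_eq_norm_sq, if_true]
    refine ⟨(hξ i).integrable_comp_of_integrable (h.integrable_sq p.1 p.2), ?_⟩
    rw [MeasurePreserving.integral_comp_of_aestronglyMeasurable (hξ i)
      (F := fun ξ => ‖G p.1 p.2 ξ - g p.1 p.2‖ ^ 2)
      (h.integrable_sq p.1 p.2).aestronglyMeasurable]
    exact h.variance_le p.1 p.2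
  · have hm : Measurable fun ξ => G p.1 p.2 ξ - g p.1 p.2 :=
      (h.measurable_point p.1 p.2).sub_const _
    have hind' := (hind.indepFun hij).comp hm hm
    refine ⟨hind'.integrable_bilin (hint i) (hint j) (innerSL ℝ), ?_⟩
    have h1 := hind'.integral_bilin (hint i) (hint j) (innerSL ℝ)
    simp only [Function.comp_apply] at h1
    rw [h.integral_sub_comp (hξ i) p.1 p.2, map_zero, zero_apply] at h1
    rw [if_neg hij]
    exact h1.le

omit [IsProbabilityMeasure P] in
lemma IsStochasticOracle.sq_norm_minibatchError (h : IsStochasticOracle ν g G σ) (hM : 0 < M)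
    (hξ : ∀ i, MeasurePreserving (ξ i) P ν) (hind : iIndepFun ξ P) (p : Vec m × Vec n) :
    Integrable (fun ω => ‖minibatchError g G (fun i => ξ i ω) p‖ ^ 2) P ∧
      ∫ ω, ‖minibatchError g G (fun i => ξ i ω) p‖ ^ 2 ∂P ≤ σ ^ 2 / M := by
  have hM' : (0 : ℝ) < M := by positivity
  have hH := h.integrable_inner_and_integral_le hξ hind p
  have heq : ∀ ω, ‖minibatchError g G (fun i => ξ i ω) p‖ ^ 2 = ((M : ℝ)⁻¹) ^ 2 *
      ∑ i, ∑ j, inner ℝ (G p.1 p.2 (ξ i ω) - g p.1 p.2) (G p.1 p.2 (ξ j ω) - g p.1 p.2) := by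
    intro ω
    rw [minibatchError_eq hM, sq_norm_smul, ← real_inner_self_eq_norm_sq, sum_inner]
    simp_rw [inner_sum]
  simp_rw [heq]
  have hi : ∀ i, Integrable (fun ω => ∑ j, inner ℝ (G p.1 p.2 (ξ i ω) - g p.1 p.2)
      (G p.1 p.2 (ξ j ω) - g p.1 p.2)) P := fun i =>
    integrable_finsetSum _ fun j _ => (hH i j).1
  refine ⟨(integrable_finsetSum _ fun i _ => hi i).const_mul _, ?_⟩
  rw [integral_const_mul, integral_finsetSum _ fun i _ => hi i]
  have hle : ∑ i, ∫ ω, ∑ j, inner ℝ (G p.1 p.2 (ξ i ω) - g p.1 p.2)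
      (G p.1 p.2 (ξ j ω) - g p.1 p.2) ∂P ≤ M * σ ^ 2 := by
    calc _ ≤ ∑ _i : Fin M, σ ^ 2 := Finset.sum_le_sum fun i _ => by
          rw [integral_finsetSum _ fun j _ => (hH i j).1]
          refine (Finset.sum_le_sum fun j _ => (hH i j).2).trans ?_
          simp
      _ = M * σ ^ 2 := by simp
  calc _ ≤ ((M : ℝ)⁻¹) ^ 2 * (M * σ ^ 2) := by gcongr
    _ = σ ^ 2 / M := by field_simp

end Noise

/-! ### Conditioning on the past rounds. -/

section Rounds

variable {m n Mx My : ℕ} {Ξx Ξy Ω : Type*} [MeasurableSpace Ξx] [MeasurableSpace Ξy]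
  [MeasurableSpace Ω] {P : Measure Ω} [IsProbabilityMeasure P] {νx : Measure Ξx} {νy : Measure Ξy}
  [IsProbabilityMeasure νx] [IsProbabilityMeasure νy]
  {gx : Vec m → Vec n → Vec m} {gy : Vec m → Vec n → Vec n}
  {Gx : Vec m → Vec n → Ξx → Vec m} {Gy : Vec m → Vec n → Ξy → Vec n} {σ : ℝ}
  {ξx : ℕ → Fin Mx → Ω → Ξx} {ξy : ℕ → Fin My → Ω → Ξy}

/-- A nonnegative function of the gradient errors of one round that is bounded by a quadratic
function of them: its expectation is bounded by the expectation of that quadratic function. -/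
lemma IsSampling.lintegral_le (hξ : IsSampling P νx νy ξx ξy) (hGx : IsStochasticOracle νx gx Gx σ)
    (hGy : IsStochasticOracle νy gy Gy σ) (hMx : 0 < Mx) (hMy : 0 < My) {R : Vec m → Vec n → ℝ}
    {A kx ky : ℝ} {bx : Vec m} {b_y : Vec n} (hR : ∀ ex ey, 0 ≤ R ex ey)
    (hkx : 0 ≤ kx) (hky : 0 ≤ ky) (hRle : ∀ ex ey, R ex ey ≤ A + inner ℝ bx ex + inner ℝ b_y ey
      + kx * ‖ex‖ ^ 2 + ky * ‖ey‖ ^ 2) (k : ℕ) (p : Vec m × Vec n) :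
    0 ≤ A + kx * (σ ^ 2 / Mx) + ky * (σ ^ 2 / My) ∧
    ∫⁻ ω, ENNReal.ofReal (R (minibatchError gx Gx (allSamples ξx ξy ω k).1 p)
      (minibatchError gy Gy (allSamples ξx ξy ω k).2 p)) ∂P
      ≤ ENNReal.ofReal (A + kx * (σ ^ 2 / Mx) + ky * (σ ^ 2 / My)) := by
  simp only [allSamples]
  set ex : Ω → Vec m := fun ω => minibatchError gx Gx (fun i => ξx k i ω) p with hex
  set ey : Ω → Vec n := fun ω => minibatchError gy Gy (fun i => ξy k i ω) p with hey
  have ix : Integrable ex P := hGx.integrable_minibatchError hMx (hξ.law_x k) p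
  have iy : Integrable ey P := hGy.integrable_minibatchError hMy (hξ.law_y k) p
  have ix0 : ∫ ω, ex ω ∂P = 0 := hGx.integral_minibatchError hMx (hξ.law_x k) p
  have iy0 : ∫ ω, ey ω ∂P = 0 := hGy.integral_minibatchError hMy (hξ.law_y k) p
  obtain ⟨ix2, ix2'⟩ := hGx.sq_norm_minibatchError hMx (hξ.law_x k) (hξ.indep_x k) p
  obtain ⟨iy2, iy2'⟩ := hGy.sq_norm_minibatchError hMy (hξ.law_y k) (hξ.indep_y k) p
  have j1 : Integrable (fun ω => inner ℝ bx (ex ω)) P := ix.const_inner bx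
  have j2 : Integrable (fun ω => inner ℝ b_y (ey ω)) P := iy.const_inner b_y
  have j3 : Integrable (fun ω => kx * ‖ex ω‖ ^ 2) P := ix2.const_mul kx
  have j4 : Integrable (fun ω => ky * ‖ey ω‖ ^ 2) P := iy2.const_mul ky
  have jj1 : Integrable (fun ω => A + inner ℝ bx (ex ω)) P := (integrable_const A).add j1
  have jj2 : Integrable (fun ω => A + inner ℝ bx (ex ω) + inner ℝ b_y (ey ω)) P := jj1.add j2
  have jj3 : Integrable (fun ω => A + inner ℝ bx (ex ω) + inner ℝ b_y (ey ω)
    + kx * ‖ex ω‖ ^ 2) P := jj2.add j3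
  have jj4 : Integrable (fun ω => A + inner ℝ bx (ex ω) + inner ℝ b_y (ey ω)
    + kx * ‖ex ω‖ ^ 2 + ky * ‖ey ω‖ ^ 2) P := jj3.add j4
  have hint : ∫ ω, (A + inner ℝ bx (ex ω) + inner ℝ b_y (ey ω) + kx * ‖ex ω‖ ^ 2
      + ky * ‖ey ω‖ ^ 2) ∂P ≤ A + kx * (σ ^ 2 / Mx) + ky * (σ ^ 2 / My) := by
    rw [integral_add jj3 j4, integral_add jj2 j3, integral_add jj1 j2,
      integral_add (integrable_const A) j1, integral_const_mul,
      integral_const_mul, integral_inner ix, integral_inner iy, ix0, iy0]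
    have := mul_le_mul_of_nonneg_left ix2' hkx
    have := mul_le_mul_of_nonneg_left iy2' hky
    simp only [integral_const, probReal_univ, smul_eq_mul, one_mul, inner_zero_right]
    linarith
  -- The majorant inherits nonnegativity from `R`, so `ENNReal.ofReal` truncates nothing when its
  -- lower integral is identified with its integral.
  have hnn : ∀ ω, 0 ≤ A + inner ℝ bx (ex ω) + inner ℝ b_y (ey ω) + kx * ‖ex ω‖ ^ 2
      + ky * ‖ey ω‖ ^ 2 := fun ω => (hR _ _).trans (hRle _ _)
  refine ⟨(integral_nonneg hnn).trans hint, ?_⟩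
  calc _ ≤ ∫⁻ ω, ENNReal.ofReal (A + inner ℝ bx (ex ω) + inner ℝ b_y (ey ω) + kx * ‖ex ω‖ ^ 2
      + ky * ‖ey ω‖ ^ 2) ∂P := lintegral_mono fun ω => ENNReal.ofReal_le_ofReal (hRle _ _)
    _ = ENNReal.ofReal (∫ ω, (A + inner ℝ bx (ex ω) + inner ℝ b_y (ey ω) + kx * ‖ex ω‖ ^ 2
      + ky * ‖ey ω‖ ^ 2) ∂P) :=
        (ofReal_integral_eq_lintegral_ofReal jj4 (Filter.Eventually.of_forall hnn)).symm
    _ ≤ _ := ENNReal.ofReal_le_ofReal hint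

omit [IsProbabilityMeasure P] [IsProbabilityMeasure νx] [IsProbabilityMeasure νy] in
lemma IsSampling.measurable_round (hξ : IsSampling P νx νy ξx ξy) (k : ℕ) :
    Measurable fun ω => allSamples ξx ξy ω k :=
  (measurable_pi_lambda _ fun i => (hξ.law_x k i).measurable).prodMk
    (measurable_pi_lambda _ fun i => (hξ.law_y k i).measurable)

/-- The events determined by the rounds `0, …, k - 1`. -/
abbrev past (ξx : ℕ → Fin Mx → Ω → Ξx) (ξy : ℕ → Fin My → Ω → Ξy) (k : ℕ) : MeasurableSpace Ω :=
  ⨆ i ∈ {i : ℕ | i < k}, MeasurableSpace.comap (fun ω => allSamples ξx ξy ω i) inferInstance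

omit [MeasurableSpace Ω] in
lemma past_mono {k l : ℕ} (h : k ≤ l) : past ξx ξy k ≤ past ξx ξy l :=
  biSup_mono fun _ hi => lt_of_lt_of_le hi h

omit [MeasurableSpace Ω] in
lemma measurable_past_round {k i : ℕ} (h : i < k) :
    Measurable[past ξx ξy k] fun ω => allSamples ξx ξy ω i := by
  refine Measurable.mono (comap_measurable _) ?_ le_rfl
  exact le_biSup (fun i => MeasurableSpace.comap (fun ω => allSamples ξx ξy ω i) inferInstance)
    (show i ∈ {i : ℕ | i < k} from h)

omit [IsProbabilityMeasure P] [IsProbabilityMeasure νx] [IsProbabilityMeasure νy] in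
lemma IsSampling.past_le (hξ : IsSampling P νx νy ξx ξy) (k : ℕ) :
    past ξx ξy k ≤ ‹MeasurableSpace Ω› :=
  iSup₂_le fun i _ => (hξ.measurable_round i).comap_le

omit [IsProbabilityMeasure P] [IsProbabilityMeasure νx] [IsProbabilityMeasure νy] in
-- Grouping independent rounds over the disjoint index sets `{i | i < k}` and `{k}`.
lemma IsSampling.indepFun (hξ : IsSampling P νx νy ξx ξy) {k : ℕ} {S : Type*} [MeasurableSpace S]
    {X : Ω → S} (hX : Measurable[past ξx ξy k] X) :
    IndepFun X (fun ω => allSamples ξx ξy ω k) P := by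
  have h := indep_iSup_of_disjoint (fun i => (hξ.measurable_round i).comap_le) hξ.indep_rounds
    (S := {i | i < k}) (T := {k}) (by simp)
  simp only [Set.mem_singleton_iff, iSup_iSup_eq_left] at h
  exact indep_of_indep_of_le_left h hX.comap_le

omit [IsProbabilityMeasure νx] [IsProbabilityMeasure νy] in
/-- To bound the expectation of a function of the past and of the current round, one may freeze
the past. -/
lemma IsSampling.lintegral_le_of_forall (hξ : IsSampling P νx νy ξx ξy) {k : ℕ} {S : Type*}
    [MeasurableSpace S] {X : Ω → S} (hX : Measurable[past ξx ξy k] X)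
    {F : S × ((Fin Mx → Ξx) × (Fin My → Ξy)) → ENNReal} {H : S → ENNReal} (hF : Measurable F)
    (h : ∀ z, ∫⁻ ω, F (z, allSamples ξx ξy ω k) ∂P ≤ H z) :
    ∫⁻ ω, F (X ω, allSamples ξx ξy ω k) ∂P ≤ ∫⁻ ω, H (X ω) ∂P := by
  have hX' : Measurable X := hX.mono (hξ.past_le k) le_rfl
  have hS := hξ.measurable_round k
  have hp := (indepFun_iff_map_prod_eq_prod_map_map hX'.aemeasurable hS.aemeasurable).1
    (hξ.indepFun hX)
  calc _ = ∫⁻ z, F z ∂(P.map fun ω => (X ω, allSamples ξx ξy ω k)) :=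
        (lintegral_map hF (hX'.prodMk hS)).symm
    _ = ∫⁻ z, ∫⁻ s, F (z, s) ∂(P.map fun ω => allSamples ξx ξy ω k) ∂(P.map X) := by
        have : IsProbabilityMeasure (P.map fun ω => allSamples ξx ξy ω k) :=
          Measure.isProbabilityMeasure_map hS.aemeasurable
        rw [hp, lintegral_prod _ hF.aemeasurable]
    _ ≤ ∫⁻ z, H z ∂(P.map X) := by
        refine lintegral_mono fun z => ?_
        rw [lintegral_map (f := fun s => F (z, s)) (hF.comp measurable_prodMk_left) hS]
        exact h z
    -- Only this inequality is needed, so `H` may be nonmeasurable.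
    _ ≤ ∫⁻ ω, H (X ω) ∂P := lintegral_map_le _ _

lemma IsStochasticOracle.measurable_minibatch {d M : ℕ} {Ξ : Type*} [MeasurableSpace Ξ]
    {ν : Measure Ξ} {g : Vec m → Vec n → Vec d} {G : Vec m → Vec n → Ξ → Vec d}
    (h : IsStochasticOracle ν g G σ) :
    Measurable fun q : (Vec m × Vec n) × (Fin M → Ξ) => minibatch G q.2 q.1 := by
  refine Measurable.const_smul (Finset.measurable_fun_sum Finset.univ fun i _ => ?_) (M : ℝ)⁻¹
  exact h.measurable.comp (measurable_fst.prodMk ((measurable_pi_apply i).comp measurable_snd))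

end Rounds

lemma sum_le_of_descent {V L : ℕ → ENNReal} {ν : ENNReal} (h : ∀ t, V (t + 1) + L t ≤ V t + ν)
    (T : ℕ) : V T + ∑ t ∈ Finset.range T, L t ≤ V 0 + T * ν := by
  induction T with
  | zero => simp
  | succ T ih =>
    rw [Finset.sum_range_succ]
    calc V (T + 1) + (∑ t ∈ Finset.range T, L t + L T)
        = V (T + 1) + L T + ∑ t ∈ Finset.range T, L t := by ring
      _ ≤ V T + ν + ∑ t ∈ Finset.range T, L t := by exact add_le_add (h T) le_rfl
      _ = V T + ∑ t ∈ Finset.range T, L t + ν := by ring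
      _ ≤ V 0 + T * ν + ν := by gcongr
      _ = _ := by push_cast; ring

/-! ### Averaging over a random index. -/

section UniformIndex

variable {Ω A : Type*} [MeasurableSpace Ω] [MeasurableSpace A] {P : Measure Ω}
  [IsProbabilityMeasure P] {S : Finset ℕ} {Z : Ω → A} {τ : Ω → ℕ}

lemma IsUniformIndex.measure_eq (h : IsUniformIndex P S Z τ) {t : ℕ} (ht : t ∈ S) :
    P (τ ⁻¹' {t}) = (S.card : ENNReal)⁻¹ := by
  have h1 := h.uniform t ht
  have h2 : P (τ ⁻¹' {t}) = ENNReal.ofReal (P.real {ω | τ ω = t}) :=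
    (ofReal_measureReal (μ := P) (s := τ ⁻¹' {t})).symm
  have hS : 0 < S.card := Finset.card_pos.2 ⟨t, ht⟩
  rw [h2, h1, one_div, ENNReal.ofReal_inv_of_pos (by positivity), ENNReal.ofReal_natCast]

/-- The prescribed masses on `S` already add up to one, so nothing is left outside. -/
lemma IsUniformIndex.ae_mem (h : IsUniformIndex P S Z τ) (hS : S.Nonempty) :
    ∀ᵐ ω ∂P, τ ω ∈ S := by
  have hm : MeasurableSet (τ ⁻¹' (S : Set ℕ)) := h.measurable S.measurableSet
  have h1 : P (τ ⁻¹' (S : Set ℕ)) = 1 := by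
    have : τ ⁻¹' (S : Set ℕ) = ⋃ t ∈ S, τ ⁻¹' {t} := by ext; simp
    rw [this, measure_biUnion_finset (fun i _ j _ hij =>
      (Set.disjoint_singleton.2 hij).preimage τ) fun t _ => h.measurable (measurableSet_singleton t)]
    rw [Finset.sum_congr rfl fun t ht => h.measure_eq ht, Finset.sum_const, nsmul_eq_mul]
    exact ENNReal.mul_inv_cancel (by simpa using hS.ne_empty) (ENNReal.natCast_ne_top _)
  have := (prob_compl_eq_zero_iff hm).2 h1
  exact this

lemma IsUniformIndex.lintegral_eq (h : IsUniformIndex P S Z τ) (hZ : Measurable Z)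
    (hS : S.Nonempty) {F : ℕ → A → ENNReal} (hF : ∀ t, Measurable (F t)) :
    ∫⁻ ω, F (τ ω) (Z ω) ∂P = (S.card : ENNReal)⁻¹ * ∑ t ∈ S, ∫⁻ ω, F t (Z ω) ∂P := by
  have h1 : ∀ᵐ ω ∂P, F (τ ω) (Z ω)
      = ∑ t ∈ S, (Set.indicator {t} (fun _ => (1 : ENNReal)) (τ ω)) * F t (Z ω) := by
    filter_upwards [h.ae_mem hS] with ω hω
    rw [Finset.sum_eq_single_of_mem _ hω fun t _ ht => by
      rw [Set.indicator_of_notMem (by simpa using ht.symm), zero_mul]]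
    simp
  have hi : ∀ t, Measurable (Set.indicator {t} (fun _ : ℕ => (1 : ENNReal))) := fun t =>
    measurable_of_countable _
  have hm : ∀ t, Measurable fun ω =>
      Set.indicator {t} (fun _ : ℕ => (1 : ENNReal)) (τ ω) * F t (Z ω) := fun t =>
    ((hi t).comp h.measurable).mul ((hF t).comp hZ)
  rw [lintegral_congr_ae h1, lintegral_finsetSum _ fun t _ => hm t, Finset.mul_sum]
  refine Finset.sum_congr rfl fun t ht => ?_
  have h2 := lintegral_mul_eq_lintegral_mul_lintegral_of_indepFun ((hi t).comp h.measurable)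
    ((hF t).comp hZ) (h.indep.comp (hi t) (hF t))
  simp only [Pi.mul_apply, Function.comp_apply] at h2
  rw [h2, ← h.measure_eq ht]
  congr 1
  have : (fun ω => Set.indicator {t} (fun _ => (1 : ENNReal)) (τ ω))
      = Set.indicator (τ ⁻¹' {t}) 1 := by
    ext ω; simp [Set.indicator]
  rw [this, lintegral_indicator_one (h.measurable (measurableSet_singleton t))]

/-- The passage from lower integrals back to an honest expectation: finiteness of the averaged sum
supplies integrability. The factor `α` is the stepsize weight with which gradients occur in the
telescoped descent. -/
lemma IsUniformIndex.integral_le (h : IsUniformIndex P S Z τ) (hZ : Measurable Z)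
    (hS : S.Nonempty) {F : ℕ → A → ℝ} (hF : ∀ t, Measurable (F t)) (hF0 : ∀ t z, 0 ≤ F t z)
    {α ε : ℝ} (hα : 0 < α)
    (hle : ∑ t ∈ S, ∫⁻ ω, ENNReal.ofReal (α * F t (Z ω)) ∂P
      ≤ ENNReal.ofReal (α * (S.card * ε ^ 2))) :
    Integrable (fun ω => F (τ ω) (Z ω)) P ∧ ∫ ω, F (τ ω) (Z ω) ∂P ≤ ε ^ 2 := by
  have hm : Measurable fun ω => F (τ ω) (Z ω) := by
    have : Measurable fun q : ℕ × A => F q.1 q.2 := measurable_from_prod_countable_right hF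
    exact this.comp (h.measurable.prodMk hZ)
  have hS0 : (S.card : ENNReal) ≠ 0 := by simpa using hS.ne_empty
  have hα' : ENNReal.ofReal α ≠ 0 := by simpa using hα
  have h1 : ∫⁻ ω, ENNReal.ofReal (F (τ ω) (Z ω)) ∂P ≤ ENNReal.ofReal (ε ^ 2) := by
    rw [h.lintegral_eq hZ hS (F := fun t z => ENNReal.ofReal (F t z))
      fun t => (hF t).ennreal_ofReal]
    rw [← ENNReal.mul_le_mul_iff_right hS0 (ENNReal.natCast_ne_top _), ← mul_assoc,
      ENNReal.mul_inv_cancel hS0 (ENNReal.natCast_ne_top _), one_mul,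
      ← ENNReal.mul_le_mul_iff_right hα' ENNReal.ofReal_ne_top, Finset.mul_sum]
    simp_rw [ENNReal.ofReal_mul hα.le] at hle
    rw [ENNReal.ofReal_mul (Nat.cast_nonneg _), ENNReal.ofReal_natCast] at hle
    have hc : ∀ t, ∫⁻ ω, ENNReal.ofReal α * ENNReal.ofReal (F t (Z ω)) ∂P
        = ENNReal.ofReal α * ∫⁻ ω, ENNReal.ofReal (F t (Z ω)) ∂P := fun t =>
      lintegral_const_mul _ ((hF t).comp hZ).ennreal_ofReal
    simp_rw [hc] at hle
    exact hle
  have hi : Integrable (fun ω => F (τ ω) (Z ω)) P := by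
    refine (lintegral_ofReal_ne_top_iff_integrable hm.aestronglyMeasurable
      (Filter.Eventually.of_forall fun ω => hF0 _ _)).1 ?_
    exact (h1.trans_lt ENNReal.ofReal_lt_top).ne
  refine ⟨hi, ?_⟩
  rw [integral_eq_lintegral_of_nonneg_ae (Filter.Eventually.of_forall fun ω => hF0 _ _)
    hm.aestronglyMeasurable]
  exact (ENNReal.toReal_mono ENNReal.ofReal_ne_top h1).trans
    (ENNReal.toReal_ofReal (sq_nonneg ε)).le

end UniformIndex

/-! ### Minibatch pairs, moves and continuity. -/

section Common

variable {m n : ℕ} {f : Vec m → Vec n → ℝ} {ℓ μ κ : ℝ}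

/-- Both minibatch estimators at the point `p`. -/
def minibatchPair {Mx My : ℕ} {Ξx Ξy : Type*} (Gx : Vec m → Vec n → Ξx → Vec m)
    (Gy : Vec m → Vec n → Ξy → Vec n) (s : (Fin Mx → Ξx) × (Fin My → Ξy)) (p : Vec m × Vec n) :
    Vec m × Vec n :=
  (minibatch Gx s.1 p, minibatch Gy s.2 p)

lemma measurable_minibatchPair {Mx My : ℕ} {Ξx Ξy : Type*} [MeasurableSpace Ξx]
    [MeasurableSpace Ξy] {νx : Measure Ξx} {νy : Measure Ξy} {Gx : Vec m → Vec n → Ξx → Vec m}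
    {Gy : Vec m → Vec n → Ξy → Vec n} {σ : ℝ} {gx : Vec m → Vec n → Vec m}
    {gy : Vec m → Vec n → Vec n} (hGx : IsStochasticOracle νx gx Gx σ)
    (hGy : IsStochasticOracle νy gy Gy σ) :
    Measurable fun q : (Vec m × Vec n) × ((Fin Mx → Ξx) × (Fin My → Ξy)) =>
      minibatchPair Gx Gy q.2 q.1 :=
  (hGx.measurable_minibatch.comp (measurable_fst.prodMk measurable_snd.fst)).prodMk
    (hGy.measurable_minibatch.comp (measurable_fst.prodMk measurable_snd.snd))

/-- Moving from `p` along `(-ηx g₁, ηy g₂)`. -/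
def move (ηx ηy : ℝ) (p g : Vec m × Vec n) : Vec m × Vec n :=
  (p.1 - ηx • g.1, p.2 + ηy • g.2)

lemma continuous_move (ηx ηy : ℝ) :
    Continuous fun q : (Vec m × Vec n) × (Vec m × Vec n) => move ηx ηy q.1 q.2 := by
  unfold move
  fun_prop

lemma IsProblem.continuous_primal (hf : IsProblem f ℓ μ κ) : Continuous (primal f) :=
  continuous_iff_continuousAt.2 fun x =>
    (hasGradientAt_primal hf.ℓ_pos hf.μ_pos hf.κ_eq hf.smooth hf.conc x).continuousAt

lemma IsProblem.continuous_gradient_primal (hf : IsProblem f ℓ μ κ) :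
    Continuous (gradient (primal f)) :=
  Minimax.continuous_gradient_primal hf.ℓ_pos hf.μ_pos hf.smooth hf.conc

lemma IsProblem.continuous_argmaxY (hf : IsProblem f ℓ μ κ) : Continuous (argmaxY f) :=
  Minimax.continuous_argmaxY hf.ℓ_pos hf.μ_pos hf.smooth hf.conc

end Common

/-! ### Stochastic extragradient. -/

section Extragradient

variable {m n : ℕ} {f : Vec m → Vec n → ℝ} {ℓ μ κ c ηx ηy : ℝ}

/-- The potential of extragradient. -/
def egPotential (f : Vec m → Vec n → ℝ) (ℓ κ ηx : ℝ) (p : Vec m × Vec n) : ℝ :=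
  primal f p.1 - (⨅ x, primal f x) + dualWeight ℓ κ 4 ηx * ‖p.2 - argmaxY f p.1‖ ^ 2

/-- A bound for the expected potential after the step from `p` with midpoint
`move ηx ηy p g`, for gradient noise of variance `s`. -/
def egMidpoint (f : Vec m → Vec n → ℝ) (ℓ κ ηx ηy s : ℝ) (p g : Vec m × Vec n) : ℝ :=
  egPotential f ℓ κ ηx p
    + ηx * (-(1 / 2) * ‖gradient (primal f) p.1‖ ^ 2
      - 2 / 5 * ‖gradX f (p.1 - ηx • g.1) (p.2 + ηy • g.2)‖ ^ 2 + 3 / 2500 * ‖g.1‖ ^ 2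
      + 2 / 7 * (κ / 4) * (65 / 64 * ‖gradY f (p.1 - ηx • g.1) (p.2 + ηy • g.2) - g.2‖ ^ 2
        - 63 / 64 * ‖g.2‖ ^ 2))
    + ηx * (1 / 10) * s + ηx * (2 / 7 * (κ / 4) * (65 / 64)) * s

lemma egPotential_nonneg (h : IsStep ℓ κ c 4 ηx ηy) (hb : BddBelow (Set.range (primal f)))
    (p : Vec m × Vec n) : 0 ≤ egPotential f ℓ κ ηx p := by
  have h1 := ciInf_le hb p.1
  have h2 := h.dualWeight_pos
  have h3 : 0 ≤ dualWeight ℓ κ 4 ηx * ‖p.2 - argmaxY f p.1‖ ^ 2 := by positivity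
  unfold egPotential
  linarith

/-- At the midpoint the true gradients differ from those at the base point by little, as `ℓ² ηy² =
1/16` and `ℓ ηx ≤ 1/50`. Hence `‖w - b‖²` is absorbed by `‖b‖²` and `‖a‖²` by `‖v‖²`, up to the
noise of the first round. -/
lemma IsProblem.egMidpoint_le (hf : IsProblem f ℓ μ κ) (h : IsStep ℓ κ c 4 ηx ηy) (s : ℝ)
    (p : Vec m × Vec n) (ex : Vec m) (ey : Vec n) :
    egMidpoint f ℓ κ ηx ηy s p (gradX f p.1 p.2 + ex, gradY f p.1 p.2 + ey)
      ≤ egPotential f ℓ κ ηx p - ηx / 2 * ‖gradient (primal f) p.1‖ ^ 2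
        + ηx * (1 / 10) * s + ηx * (2 / 7 * (κ / 4) * (65 / 64)) * s
        + ηx * (1 / 200) * ‖ex‖ ^ 2 + ηx * (κ / 14 * (325 / 288)) * ‖ey‖ ^ 2 := by
  have hηx := h.ηx_pos
  have hκ1 := h.one_le_κ
  have hκ0 := h.κ_pos
  unfold egMidpoint
  simp only
  set a := gradX f p.1 p.2 + ex with ha
  set b := gradY f p.1 p.2 + ey with hb
  set v := gradX f (p.1 - ηx • a) (p.2 + ηy • b) with hv
  set w := gradY f (p.1 - ηx • a) (p.2 + ηy • b) with hw
  have hℓηy : ℓ ^ 2 * ηy ^ 2 = 1 / 16 := by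
    have := h.ℓ_pos.ne'
    rw [h.ηy_eq]; field_simp; norm_num
  have e1 := hf.smooth.sq_gradX_sub_le p.1 (p.1 - ηx • a) p.2 (p.2 + ηy • b)
  have e2 := hf.smooth.sq_gradY_sub_le (p.1 - ηx • a) p.1 (p.2 + ηy • b) p.2
  rw [← hv, sub_sub_cancel, sub_add_cancel_left, norm_neg, sq_norm_smul, sq_norm_smul,
    ← mul_assoc, ← mul_assoc, hℓηy] at e1
  rw [← hw, sub_sub_cancel_left, add_sub_cancel_left, norm_neg, sq_norm_smul, sq_norm_smul,
    ← mul_assoc, ← mul_assoc, hℓηy] at e2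
  have e3 := mul_le_mul_of_nonneg_right h.sq_ℓ_mul_sq_le (sq_nonneg ‖a‖)
  have hA : ‖a‖ ^ 2 ≤ 2 * ‖ex‖ ^ 2 + 4 * ‖v‖ ^ 2 + 4 / 2500 * ‖a‖ ^ 2 + 1 / 4 * ‖b‖ ^ 2 := by
    have h1 := sq_norm_add_le_mul (gradX f p.1 p.2) ex one_pos
    have h2 := sq_norm_add_le_mul (gradX f p.1 p.2 - v) v one_pos
    rw [sub_add_cancel] at h2
    rw [← ha] at h1
    linarith
  have hZ : ‖w - b‖ ^ 2 ≤ 10 * (ℓ ^ 2 * ηx ^ 2 * ‖a‖ ^ 2) + 10 / 16 * ‖b‖ ^ 2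
      + 10 / 9 * ‖ey‖ ^ 2 := by
    -- The lopsided parameter `9` keeps the noise factor at `10/9`; the other factor `10` is
    -- affordable, since `10/16 · 65/64 < 63/64`.
    have h1 := sq_norm_add_le_mul (w - gradY f p.1 p.2) (-ey) (by norm_num : (0 : ℝ) < 9)
    rw [norm_neg, show w - gradY f p.1 p.2 + -ey = w - b by rw [hb]; abel] at h1
    linarith
  have hZ' := mul_le_mul_of_nonneg_left hZ (by positivity : 0 ≤ κ / 14)
  have e4 : κ / 14 * (ℓ ^ 2 * ηx ^ 2 * ‖a‖ ^ 2) ≤ 1 / 35000 * ‖a‖ ^ 2 := by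
    have h1 := mul_le_mul_of_nonneg_right h.sq_mul_sq_le (sq_nonneg ‖a‖)
    have h2 : κ * (ℓ ^ 2 * ηx ^ 2 * ‖a‖ ^ 2) ≤ κ ^ 2 * (ℓ ^ 2 * ηx ^ 2 * ‖a‖ ^ 2) :=
      mul_le_mul_of_nonneg_right (by nlinarith) (by positivity)
    linarith
  have hB : ‖b‖ ^ 2 ≤ κ * ‖b‖ ^ 2 := le_mul_of_one_le_left (sq_nonneg _) hκ1
  have key : -(2 / 5) * ‖v‖ ^ 2 + 3 / 2500 * ‖a‖ ^ 2
      + 2 / 7 * (κ / 4) * (65 / 64 * ‖w - b‖ ^ 2 - 63 / 64 * ‖b‖ ^ 2)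
      ≤ 1 / 200 * ‖ex‖ ^ 2 + κ / 14 * (325 / 288) * ‖ey‖ ^ 2 := by
    have h1 := sq_nonneg ‖v‖
    have h2 := sq_nonneg ‖ex‖
    have h3 := sq_nonneg ‖b‖
    have h4 := sq_nonneg ‖a‖
    linarith
  have := mul_le_mul_of_nonneg_left key hηx.le
  linarith

lemma IsProblem.continuous_egPotential (hf : IsProblem f ℓ μ κ) :
    Continuous (egPotential f ℓ κ ηx) := by
  have h1 := hf.continuous_primal
  have h2 := hf.continuous_argmaxY
  unfold egPotential
  fun_prop

lemma IsProblem.continuous_egMidpoint (hf : IsProblem f ℓ μ κ) (s : ℝ) :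
    Continuous fun q : (Vec m × Vec n) × (Vec m × Vec n) =>
      egMidpoint f ℓ κ ηx ηy s q.1 q.2 := by
  have h1 := hf.continuous_egPotential (ηx := ηx)
  have h2 := hf.continuous_gradient_primal
  have h3 := (hf.smooth.continuous_gradX hf.ℓ_pos).comp
    (continuous_move (m := m) (n := n) ηx ηy)
  have h4 := (hf.smooth.continuous_gradY hf.ℓ_pos).comp
    (continuous_move (m := m) (n := n) ηx ηy)
  simp only [move, Function.comp_def] at h3 h4
  unfold egMidpoint
  fun_prop

section Expectation

variable {M : ℕ} {Ξx Ξy Ω : Type*} [MeasurableSpace Ξx] [MeasurableSpace Ξy]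
  [MeasurableSpace Ω] {P : Measure Ω} [IsProbabilityMeasure P] {νx : Measure Ξx} {νy : Measure Ξy}
  {Gx : Vec m → Vec n → Ξx → Vec m} {Gy : Vec m → Vec n → Ξy → Vec n} {σ ε : ℝ}
  {ξx : ℕ → Fin M → Ω → Ξx} {ξy : ℕ → Fin M → Ω → Ξy}

omit [MeasurableSpace Ξx] [MeasurableSpace Ξy] in
lemma eg_succ (p₀ : Vec m × Vec n) (s : ℕ → (Fin M → Ξx) × (Fin M → Ξy)) (t : ℕ) :
    eg Gx Gy ηx ηy p₀ s (t + 1) = move ηx ηy (eg Gx Gy ηx ηy p₀ s t)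
      (minibatchPair Gx Gy (s (2 * t + 1)) (move ηx ηy (eg Gx Gy ηx ηy p₀ s t)
        (minibatchPair Gx Gy (s (2 * t)) (eg Gx Gy ηx ηy p₀ s t)))) := rfl

lemma measurable_eg {gx : Vec m → Vec n → Vec m} {gy : Vec m → Vec n → Vec n}
    (hGx : IsStochasticOracle νx gx Gx σ) (hGy : IsStochasticOracle νy gy Gy σ)
    (p₀ : Vec m × Vec n) {Ω' : Type*} {mΩ' : MeasurableSpace Ω'}
    {s : Ω' → ℕ → (Fin M → Ξx) × (Fin M → Ξy)} (t : ℕ)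
    (hs : ∀ i < 2 * t, Measurable fun ω => s ω i) :
    Measurable fun ω => eg Gx Gy ηx ηy p₀ (s ω) t := by
  induction t with
  | zero => exact measurable_const
  | succ t ih =>
    have h0 := ih fun i hi => hs i (by omega)
    have hmv := (continuous_move (m := m) (n := n) ηx ηy).measurable
    have hmb := measurable_minibatchPair (Mx := M) (My := M) hGx hGy
    simp_rw [eg_succ]
    exact hmv.comp (h0.prodMk (hmb.comp ((hmv.comp (h0.prodMk (hmb.comp
      (h0.prodMk (hs (2 * t) (by omega)))))).prodMk (hs (2 * t + 1) (by omega)))))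

variable [IsProbabilityMeasure νx] [IsProbabilityMeasure νy]

/-- Average over the second round of an iteration, the midpoint being frozen. The nonnegativity is
needed because `egMidpoint` is in turn the function averaged over the first round. -/
lemma egMidpoint_nonneg_and_lintegral_le (hf : IsProblem f ℓ μ κ) (h : IsStep ℓ κ c 4 ηx ηy)
    (hb : BddBelow (Set.range (primal f))) (hξ : IsSampling P νx νy ξx ξy)
    (hGx : IsStochasticOracle νx (gradX f) Gx σ) (hGy : IsStochasticOracle νy (gradY f) Gy σ)
    (hM : 0 < M) (k : ℕ) (p g : Vec m × Vec n) :
    0 ≤ egMidpoint f ℓ κ ηx ηy (σ ^ 2 / M) p g ∧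
    ∫⁻ ω, ENNReal.ofReal (egPotential f ℓ κ ηx (move ηx ηy p
      (minibatchPair Gx Gy (allSamples ξx ξy ω k) (move ηx ηy p g)))) ∂P
      ≤ ENNReal.ofReal (egMidpoint f ℓ κ ηx ηy (σ ^ 2 / M) p g) := by
  have hκ0 := h.κ_pos; have hηx := h.ηx_pos
  obtain ⟨bx, b_y, hstep⟩ := hf.exists_step h p.1 g.1 p.2 g.2 _ _ rfl rfl
  have H := hξ.lintegral_le hGx hGy hM hM (R := fun ex ey => egPotential f ℓ κ ηx (move ηx ηy p
      (gradX f (move ηx ηy p g).1 (move ηx ηy p g).2 + ex,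
        gradY f (move ηx ηy p g).1 (move ηx ηy p g).2 + ey)))
    (A := egPotential f ℓ κ ηx p
    + ηx * (-(1 / 2) * ‖gradient (primal f) p.1‖ ^ 2
      - 2 / 5 * ‖gradX f (p.1 - ηx • g.1) (p.2 + ηy • g.2)‖ ^ 2 + 3 / 2500 * ‖g.1‖ ^ 2
      + 2 / 7 * (κ / 4) * (65 / 64 * ‖gradY f (p.1 - ηx • g.1) (p.2 + ηy • g.2) - g.2‖ ^ 2
        - 63 / 64 * ‖g.2‖ ^ 2)))
    (kx := ηx * (1 / 10)) (ky := ηx * (2 / 7 * (κ / 4) * (65 / 64))) (bx := bx) (b_y := b_y)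
    (fun _ _ => egPotential_nonneg h hb _) (by positivity) (by positivity)
    (fun ex ey => by
      have := hstep ex ey
      simp only [egPotential, move]
      linarith) k (move ηx ηy p g)
  simp only [add_minibatchError] at H
  exact H

lemma lintegral_egMidpoint_le (hf : IsProblem f ℓ μ κ) (h : IsStep ℓ κ c 4 ηx ηy)
    (hb : BddBelow (Set.range (primal f))) (hξ : IsSampling P νx νy ξx ξy)
    (hGx : IsStochasticOracle νx (gradX f) Gx σ) (hGy : IsStochasticOracle νy (gradY f) Gy σ)
    (hM : 0 < M) (hσ : κ * (σ ^ 2 / M) ≤ ε ^ 2) (k : ℕ) (p : Vec m × Vec n) :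
    ∫⁻ ω, (ENNReal.ofReal (egMidpoint f ℓ κ ηx ηy (σ ^ 2 / M) p
      (minibatchPair Gx Gy (allSamples ξx ξy ω k) p))
      + ENNReal.ofReal (ηx / 2 * ‖gradient (primal f) p.1‖ ^ 2)) ∂P
      ≤ ENNReal.ofReal (egPotential f ℓ κ ηx p) + ENNReal.ofReal (ηx * (13 / 50 * ε ^ 2)) := by
  have hκ0 := h.κ_pos; have hηx := h.ηx_pos
  have H := hξ.lintegral_le hGx hGy hM hM (R := fun ex ey => egMidpoint f ℓ κ ηx ηy (σ ^ 2 / M) p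
      (gradX f p.1 p.2 + ex, gradY f p.1 p.2 + ey))
    (A := egPotential f ℓ κ ηx p - ηx / 2 * ‖gradient (primal f) p.1‖ ^ 2
        + ηx * (1 / 10) * (σ ^ 2 / M) + ηx * (2 / 7 * (κ / 4) * (65 / 64)) * (σ ^ 2 / M))
    (kx := ηx * (1 / 200)) (ky := ηx * (κ / 14 * (325 / 288))) (bx := 0) (b_y := 0)
    (fun _ _ => (egMidpoint_nonneg_and_lintegral_le hf h hb hξ hGx hGy hM k _ _).1)
    (by positivity) (by positivity)
    (fun ex ey => by
      simp only [inner_zero_left, add_zero]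
      exact hf.egMidpoint_le h _ p ex ey) k p
  simp only [add_minibatchError] at H
  have hN : 0 ≤ ηx / 2 * ‖gradient (primal f) p.1‖ ^ 2 := by positivity
  rw [lintegral_add_right _ measurable_const, lintegral_const, measure_univ, mul_one]
  refine (add_le_add H.2 le_rfl).trans ?_
  rw [← ENNReal.ofReal_add H.1 hN, ← ENNReal.ofReal_add (egPotential_nonneg h hb p)
    (by positivity)]
  refine ENNReal.ofReal_le_ofReal ?_
  -- Two primal and two dual noise contributions are collected: `1/10 + 1/200 + (65/64 + 325/288)/14
  -- < 13/50`.
  have h1 : σ ^ 2 / M ≤ κ * (σ ^ 2 / M) :=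
    le_mul_of_one_le_left (by positivity) h.one_le_κ
  have h2 := mul_le_mul_of_nonneg_left hσ hηx.le
  have h3 := mul_le_mul_of_nonneg_left h1 hηx.le
  have h4 : 0 ≤ ηx * ε ^ 2 := by positivity
  linarith

lemma eg_descent (hf : IsProblem f ℓ μ κ) (h : IsStep ℓ κ c 4 ηx ηy)
    (hb : BddBelow (Set.range (primal f))) (hξ : IsSampling P νx νy ξx ξy)
    (hGx : IsStochasticOracle νx (gradX f) Gx σ) (hGy : IsStochasticOracle νy (gradY f) Gy σ)
    (hM : 0 < M) (hσ : κ * (σ ^ 2 / M) ≤ ε ^ 2) (p₀ : Vec m × Vec n) (t : ℕ) :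
    ∫⁻ ω, ENNReal.ofReal (egPotential f ℓ κ ηx
        (eg Gx Gy ηx ηy p₀ (allSamples ξx ξy ω) (t + 1))) ∂P
      + ∫⁻ ω, ENNReal.ofReal (ηx / 2 *
        ‖gradient (primal f) (eg Gx Gy ηx ηy p₀ (allSamples ξx ξy ω) t).1‖ ^ 2) ∂P
      ≤ ∫⁻ ω, ENNReal.ofReal (egPotential f ℓ κ ηx
        (eg Gx Gy ηx ηy p₀ (allSamples ξx ξy ω) t)) ∂P
        + ENNReal.ofReal (ηx * (13 / 50 * ε ^ 2)) := by
  have hp : Measurable[past ξx ξy (2 * t)]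
      fun ω => eg Gx Gy ηx ηy p₀ (allSamples ξx ξy ω) t :=
    measurable_eg hGx hGy p₀ t fun i hi => measurable_past_round hi
  have hmb := measurable_minibatchPair (Mx := M) (My := M) hGx hGy
  have hmv := (continuous_move (m := m) (n := n) ηx ηy).measurable
  have hmid := (hf.continuous_egMidpoint (ηx := ηx) (ηy := ηy) (σ ^ 2 / M)).measurable
  have hpot := (hf.continuous_egPotential (ηx := ηx)).measurable
  have hgr := hf.continuous_gradient_primal.measurable
  have h1 : ∫⁻ ω, ENNReal.ofReal (egPotential f ℓ κ ηx
        (eg Gx Gy ηx ηy p₀ (allSamples ξx ξy ω) (t + 1))) ∂P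
      ≤ ∫⁻ ω, ENNReal.ofReal (egMidpoint f ℓ κ ηx ηy (σ ^ 2 / M)
        (eg Gx Gy ηx ηy p₀ (allSamples ξx ξy ω) t)
        (minibatchPair Gx Gy (allSamples ξx ξy ω (2 * t))
          (eg Gx Gy ηx ηy p₀ (allSamples ξx ξy ω) t))) ∂P := by
    -- The iterate depends on rounds below `2t` only; the midpoint gradients use round `2t + 1`, for
    -- which the first minibatch already belongs to the past.
    have hX : Measurable[past ξx ξy (2 * t + 1)] fun ω =>
        (eg Gx Gy ηx ηy p₀ (allSamples ξx ξy ω) t, minibatchPair Gx Gy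
          (allSamples ξx ξy ω (2 * t)) (eg Gx Gy ηx ηy p₀ (allSamples ξx ξy ω) t)) := by
      have hp' := hp.mono (past_mono (Nat.le_succ (2 * t))) le_rfl
      exact hp'.prodMk (hmb.comp (hp'.prodMk (measurable_past_round (Nat.lt_succ_self _))))
    refine hξ.lintegral_le_of_forall hX (F := fun q => ENNReal.ofReal (egPotential f ℓ κ ηx
      (move ηx ηy q.1.1 (minibatchPair Gx Gy q.2 (move ηx ηy q.1.1 q.1.2)))))
      (H := fun z => ENNReal.ofReal (egMidpoint f ℓ κ ηx ηy (σ ^ 2 / M) z.1 z.2))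
      ?_ fun z => (egMidpoint_nonneg_and_lintegral_le hf h hb hξ hGx hGy hM _ z.1 z.2).2
    exact (hpot.comp (hmv.comp (measurable_fst.fst.prodMk (hmb.comp
      ((hmv.comp measurable_fst).prodMk measurable_snd))))).ennreal_ofReal
  have hmN : Measurable fun p : Vec m × Vec n =>
      ENNReal.ofReal (ηx / 2 * ‖gradient (primal f) p.1‖ ^ 2) :=
    (((hgr.comp measurable_fst).norm.pow_const 2).const_mul _).ennreal_ofReal
  have hN : Measurable fun ω => ENNReal.ofReal (ηx / 2 *
      ‖gradient (primal f) (eg Gx Gy ηx ηy p₀ (allSamples ξx ξy ω) t).1‖ ^ 2) :=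
    hmN.comp (hp.mono (hξ.past_le _) le_rfl)
  have h2 := hξ.lintegral_le_of_forall hp (F := fun q => ENNReal.ofReal (egMidpoint f ℓ κ ηx ηy
      (σ ^ 2 / M) q.1 (minibatchPair Gx Gy q.2 q.1))
      + ENNReal.ofReal (ηx / 2 * ‖gradient (primal f) q.1.1‖ ^ 2))
    (H := fun p => ENNReal.ofReal (egPotential f ℓ κ ηx p)
      + ENNReal.ofReal (ηx * (13 / 50 * ε ^ 2)))
    ((hmid.comp (measurable_fst.prodMk hmb)).ennreal_ofReal.add (hmN.comp measurable_fst))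
    fun p => lintegral_egMidpoint_le hf h hb hξ hGx hGy hM hσ _ p
  rw [lintegral_add_right _ hN, lintegral_add_right _ measurable_const,
    lintegral_const, measure_univ, mul_one] at h2
  exact (add_le_add h1 le_rfl).trans h2

theorem eg_output (hf : IsProblem f ℓ μ κ) (h : IsStep ℓ κ c 4 ηx ηy)
    (hb : BddBelow (Set.range (primal f))) (hξ : IsSampling P νx νy ξx ξy)
    (hGx : IsStochasticOracle νx (gradX f) Gx σ) (hGy : IsStochasticOracle νy (gradY f) Gy σ)
    (hM : 0 < M) (hσ : κ * (σ ^ 2 / M) ≤ ε ^ 2) (p₀ : Vec m × Vec n) {T : ℕ} (hT0 : 0 < T)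
    (hT : 6 * (κ ^ 2 * ℓ * (primal f p₀.1 - ⨅ x, primal f x) / c
      + κ * ℓ ^ 2 * ‖p₀.2 - argmaxY f p₀.1‖ ^ 2) ≤ T * ε ^ 2)
    {τ : Ω → ℕ} (hτ : IsUniformIndex P (Finset.range T) (allSamples ξx ξy) τ) :
    Integrable (fun ω => ‖gradient (primal f)
      (eg Gx Gy ηx ηy p₀ (allSamples ξx ξy ω) (τ ω)).1‖ ^ 2) P ∧
    ∫ ω, ‖gradient (primal f) (eg Gx Gy ηx ηy p₀ (allSamples ξx ξy ω) (τ ω)).1‖ ^ 2 ∂P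
      ≤ ε ^ 2 := by
  have hηx := h.ηx_pos
  have hgr := hf.continuous_gradient_primal.measurable
  refine hτ.integral_le (F := fun t s => ‖gradient (primal f) (eg Gx Gy ηx ηy p₀ s t).1‖ ^ 2)
    (measurable_pi_lambda _ hξ.measurable_round) (by simpa using hT0.ne') (fun t => ?_)
    (fun _ _ => by positivity) (half_pos hηx) ?_
  · have h1 : Measurable fun s : ℕ → (Fin M → Ξx) × (Fin M → Ξy) => eg Gx Gy ηx ηy p₀ s t :=
      measurable_eg hGx hGy p₀ t fun i _ => measurable_pi_apply i
    exact (hgr.comp h1.fst).norm.pow_const 2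
  · have h1 := sum_le_of_descent (eg_descent hf h hb hξ hGx hGy hM hσ p₀) T
    refine (le_add_self.trans h1).trans ?_
    have h0 : ∀ ω, eg Gx Gy ηx ηy p₀ (allSamples ξx ξy ω) 0 = p₀ := fun _ => rfl
    simp only [h0, lintegral_const, measure_univ, mul_one, Finset.card_range]
    rw [← ENNReal.ofReal_natCast T, ← ENNReal.ofReal_mul (Nat.cast_nonneg T),
      ← ENNReal.ofReal_add (egPotential_nonneg h hb p₀) (by positivity)]
    refine ENNReal.ofReal_le_ofReal ?_
    have h2 : egPotential f ℓ κ ηx p₀ = ηx * (κ ^ 2 * ℓ * (primal f p₀.1 - ⨅ x, primal f x) / c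
        + 8 / 7 * (κ * ℓ ^ 2 * ‖p₀.2 - argmaxY f p₀.1‖ ^ 2)) := by
      have := h.ℓ_pos.ne'; have := h.κ_pos.ne'; have := h.c_pos.ne'
      rw [egPotential, dualWeight, h.ηx_eq]
      field_simp
      ring
    have h3 : 0 ≤ κ ^ 2 * ℓ * (primal f p₀.1 - ⨅ x, primal f x) / c :=
      div_nonneg (mul_nonneg (mul_nonneg (sq_nonneg κ) h.ℓ_pos.le)
        (sub_nonneg.2 (ciInf_le hb p₀.1))) h.c_pos.le
    -- Of the factor `1/2` in front of the gradients, noise consumes `13/50`; the remaining `12/50`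
    -- suffices because `6 · 12/50 ≥ 8/7`.
    have h4 : κ ^ 2 * ℓ * (primal f p₀.1 - ⨅ x, primal f x) / c
        + 8 / 7 * (κ * ℓ ^ 2 * ‖p₀.2 - argmaxY f p₀.1‖ ^ 2) ≤ 12 / 50 * (T * ε ^ 2) := by
      have : 0 ≤ T * ε ^ 2 := by positivity
      linarith
    have h5 := mul_le_mul_of_nonneg_left h4 hηx.le
    rw [h2]
    linarith

end Expectation

end Extragradient

/-! ### Stochastic optimistic gradient descent ascent. -/

section OptimisticGradient

variable {m n : ℕ} {f : Vec m → Vec n → ℝ} {ℓ μ κ c ηx ηy : ℝ}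

/-- The state of OGDA: the previous point, the minibatch gradients there, the current point. -/
abbrev OgdaState (m n : ℕ) : Type := (Vec m × Vec n) × (Vec m × Vec n) × (Vec m × Vec n)

/-- The next point of OGDA from the point `p`, with previous and current gradients `g`, `g'`. -/
def ogdaNext (ηx ηy : ℝ) (p g g' : Vec m × Vec n) : Vec m × Vec n :=
  (p.1 - ηx • g'.1 - ηx • (g'.1 - g.1), p.2 + ηy • g'.2 + ηy • (g'.2 - g.2))

/-- The potential of OGDA, in terms of the base point `(x + ηx gx, y - ηy gy)` of the past
extragradient step that leads to the current point `(x, y)`. -/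
def ogdaPotential (f : Vec m → Vec n → ℝ) (ℓ κ ηx ηy : ℝ) (z : OgdaState m n) : ℝ :=
  primal f (z.2.2.1 + ηx • z.2.1.1) - (⨅ x, primal f x)
    + dualWeight ℓ κ 6 ηx *
      ‖z.2.2.2 - ηy • z.2.1.2 - argmaxY f (z.2.2.1 + ηx • z.2.1.1)‖ ^ 2
    + ηx * (κ / 2 * ℓ ^ 2 * (‖z.2.2.1 + ηx • z.2.1.1 - z.1.1‖ ^ 2
        + ‖z.2.2.2 - ηy • z.2.1.2 - z.1.2‖ ^ 2)
      + 1 / 100 * ‖z.2.1.1‖ ^ 2 + κ / 12 * ‖z.2.1.2 - gradY f z.1.1 z.1.2‖ ^ 2)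

lemma ogdaPotential_nonneg (h : IsStep ℓ κ c 6 ηx ηy) (hb : BddBelow (Set.range (primal f)))
    (z : OgdaState m n) : 0 ≤ ogdaPotential f ℓ κ ηx ηy z := by
  have h1 := ciInf_le hb (z.2.2.1 + ηx • z.2.1.1)
  have h2 := h.dualWeight_pos
  have h3 := h.ηx_pos
  have h4 := h.κ_pos
  have h5 := sub_nonneg.2 h1
  unfold ogdaPotential
  positivity

lemma IsProblem.continuous_ogdaPotential (hf : IsProblem f ℓ μ κ) :
    Continuous (ogdaPotential f ℓ κ ηx ηy) := by
  have h1 := hf.continuous_primal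
  have h2 := hf.continuous_argmaxY
  have h3 := (hf.smooth.continuous_gradY hf.ℓ_pos).comp
    (continuous_fst : Continuous fun z : OgdaState m n => z.1)
  simp only [Function.comp_def] at h3
  unfold ogdaPotential
  fun_prop

lemma continuous_ogdaNext (ηx ηy : ℝ) :
    Continuous fun q : (Vec m × Vec n) × (Vec m × Vec n) × (Vec m × Vec n) =>
      ogdaNext ηx ηy q.1 q.2.1 q.2.2 := by
  unfold ogdaNext
  fun_prop

lemma IsStep.sq_ℓ_mul_sq_ηy (h : IsStep ℓ κ c 6 ηx ηy) : ℓ ^ 2 * ηy ^ 2 = 1 / 36 := by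
  have := h.ℓ_pos.ne'
  rw [h.ηy_eq]; field_simp; norm_num

lemma IsStep.κ_mul_le (h : IsStep ℓ κ c 6 ηx ηy) {r : ℝ} (hr : 0 ≤ r) :
    κ * (ℓ ^ 2 * (ηx ^ 2 * r)) ≤ 1 / 2500 * r := by
  have h1 := mul_le_mul_of_nonneg_right h.sq_mul_sq_le hr
  have h2 : κ * (ℓ ^ 2 * (ηx ^ 2 * r)) ≤ κ ^ 2 * (ℓ ^ 2 * (ηx ^ 2 * r)) :=
    mul_le_mul_of_nonneg_right (by nlinarith [h.one_le_κ]) (by positivity)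
  linarith

/-- The expected decrease of the OGDA potential, with the noise of the current round explicit. -/
lemma IsProblem.exists_ogda_step (hf : IsProblem f ℓ μ κ) (h : IsStep ℓ κ c 6 ηx ηy)
    (z : OgdaState m n) :
    ∃ (bx : Vec m) (b_y : Vec n), ∀ (ex : Vec m) (ey : Vec n),
      ogdaPotential f ℓ κ ηx ηy (z.2.2,
        (gradX f z.2.2.1 z.2.2.2 + ex, gradY f z.2.2.1 z.2.2.2 + ey),
        ogdaNext ηx ηy z.2.2 z.2.1
          (gradX f z.2.2.1 z.2.2.2 + ex, gradY f z.2.2.1 z.2.2.2 + ey))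
      ≤ ogdaPotential f ℓ κ ηx ηy z - ηx * (10 / 21) * ‖gradient (primal f) z.2.2.1‖ ^ 2
        + inner ℝ bx ex + inner ℝ b_y ey
        + ηx * (111 / 1000) * ‖ex‖ ^ 2 + ηx * (κ * (147 / 1000)) * ‖ey‖ ^ 2 := by
  obtain ⟨⟨xp, yp⟩, ⟨a, b⟩, x, y⟩ := z
  have hηx := h.ηx_pos
  have hκ1 := h.one_le_κ
  have hκ0 := h.κ_pos
  -- The current point is the extrapolation of the base point along the stored gradients, so the
  -- common step inequality applies at the base point.
  have hx : x + ηx • a - ηx • a = x := add_sub_cancel_right _ _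
  have hy : y - ηy • b + ηy • b = y := sub_add_cancel _ _
  obtain ⟨bx, b_y, hstep⟩ := hf.exists_step h (x + ηx • a) a (y - ηy • b) b
    (gradX f x y) (gradY f x y) (by rw [hx, hy]) (by rw [hx, hy])
  set v := gradX f x y
  set w := gradY f x y with hw
  -- Added to the common step are the cross terms of the new displacement penalty `κℓ²/2` and of
  -- `1/100 ‖v + ex‖²`; on the dual side `ℓ² ηy² = 1/36` gives `κ/36`.
  refine ⟨bx + (ηx * κ * ℓ ^ 2 * ηx ^ 2) • (v - a) + (ηx / 50) • v,
    b_y + (ηx * κ / 36) • (w - b), fun ex ey => ?_⟩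
  have hs := hstep ex ey
  unfold ogdaPotential ogdaNext
  simp only
  have c1 : x - ηx • (v + ex) - ηx • (v + ex - a) + ηx • (v + ex)
      = x + ηx • a - ηx • (v + ex) := by module
  have c2 : y + ηy • (w + ey) + ηy • (w + ey - b) - ηy • (w + ey)
      = y - ηy • b + ηy • (w + ey) := by module
  have c3 : x + ηx • a - ηx • (v + ex) - x = -(ηx • ((v - a) + ex)) := by
    module
  have c4 : y - ηy • b + ηy • (w + ey) - y = ηy • ((w - b) + ey) := by
    module
  rw [c1, c2, c3, c4, norm_neg, sq_norm_smul, sq_norm_smul, add_sub_cancel_left,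
    sq_norm_add_eq (v - a), sq_norm_add_eq (w - b), sq_norm_add_eq v]
  set rx := x + ηx • a - xp with hrx
  set ry := y - ηy • b - yp with hry
  have hηy := h.sq_ℓ_mul_sq_ηy
  -- The stale gradient `b` is compared with the true dual gradient at the previous point. The
  -- result consists of `‖b‖²`, a small multiple of `‖a‖²`, and quantities stored in the potential.
  have hZ : ‖w - b‖ ^ 2 ≤ 4 * (ℓ ^ 2 * (2 * ‖rx‖ ^ 2 + 2 * (ηx ^ 2 * ‖a‖ ^ 2)))
      + 8 * (ℓ ^ 2 * ‖ry‖ ^ 2) + 8 / 36 * ‖b‖ ^ 2 + 4 / 3 * ‖b - gradY f xp yp‖ ^ 2 := by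
    have h1 := sq_norm_add_le_mul (w - gradY f xp yp) (gradY f xp yp - b)
      (by norm_num : (0 : ℝ) < 3)
    rw [sub_add_sub_cancel, norm_sub_rev (gradY f xp yp) b] at h1
    have h2 := hf.smooth.sq_gradY_sub_le x xp y yp
    rw [← hw] at h2
    have h3 := sq_norm_add_le_mul rx (-(ηx • a)) one_pos
    rw [norm_neg, sq_norm_smul, show rx + -(ηx • a) = x - xp by rw [hrx]; abel] at h3
    have h4 := sq_norm_add_le_mul ry (ηy • b) one_pos
    rw [sq_norm_smul, show ry + ηy • b = y - yp by rw [hry]; abel] at h4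
    have h5 := mul_le_mul_of_nonneg_left h3 (sq_nonneg ℓ)
    have h6 := mul_le_mul_of_nonneg_left h4 (sq_nonneg ℓ)
    have h7 : ℓ ^ 2 * (2 * (ηy ^ 2 * ‖b‖ ^ 2)) = 2 / 36 * ‖b‖ ^ 2 := by
      linear_combination 2 * ‖b‖ ^ 2 * hηy
    linarith
  have hva : ‖v - a‖ ^ 2 ≤ 2 * ‖v‖ ^ 2 + 2 * ‖a‖ ^ 2 := by
    have h1 := sq_norm_add_le_mul v (-a) one_pos
    rw [norm_neg, ← sub_eq_add_neg] at h1
    linarith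
  -- Descent controls the gradient at the base point, the output concerns the iterate: Young with
  -- `1/20` turns `1/2` into `10/21`.
  have hN : -(1 / 2) * ‖gradient (primal f) (x + ηx • a)‖ ^ 2
      ≤ -(10 / 21) * ‖gradient (primal f) x‖ ^ 2 + 20 / 2500 * ‖a‖ ^ 2 := by
    have h1 := sq_norm_add_le_mul (gradient (primal f) (x + ηx • a))
      (gradient (primal f) x - gradient (primal f) (x + ηx • a)) (by norm_num : (0 : ℝ) < 1 / 20)
    rw [add_sub_cancel] at h1
    have h2 := sq_gradient_primal_sub_le hf.ℓ_pos hf.μ_pos hf.κ_eq hκ1 hf.smooth hf.conc x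
      (x + ηx • a)
    rw [sub_add_cancel_left, norm_neg, sq_norm_smul] at h2
    have h3 := mul_le_mul_of_nonneg_right h.sq_mul_sq_le (sq_nonneg ‖a‖)
    linarith
  have k1 := h.κ_mul_le (sq_nonneg ‖a‖)
  have k2 := h.κ_mul_le (sq_nonneg ‖v - a‖)
  have k3 := h.κ_mul_le (sq_nonneg ‖ex‖)
  have hZ' := mul_le_mul_of_nonneg_left hZ hκ0.le
  -- The weights of the potential are fixed here: `‖w - b‖²` has total coefficient `κ(65/1344 +
  -- 1/72)`, whose multiples by `8` and `4/3` stay just below `κ/2` and `κ/12`.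
  have key : -(1 / 2) * ‖gradient (primal f) (x + ηx • a)‖ ^ 2 - 2 / 5 * ‖v‖ ^ 2
      + 3 / 2500 * ‖a‖ ^ 2 + 2 / 7 * (κ / 6) * (65 / 64 * ‖w - b‖ ^ 2 - 63 / 64 * ‖b‖ ^ 2)
      + 1 / 2 * (κ * (ℓ ^ 2 * (ηx ^ 2 * ‖v - a‖ ^ 2))) + κ / 72 * ‖w - b‖ ^ 2
      + 1 / 100 * ‖v‖ ^ 2
      ≤ -(10 / 21) * ‖gradient (primal f) x‖ ^ 2
        + κ / 2 * ℓ ^ 2 * (‖rx‖ ^ 2 + ‖ry‖ ^ 2) + 1 / 100 * ‖a‖ ^ 2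
        + κ / 12 * ‖b - gradY f xp yp‖ ^ 2 := by
    have h1 : 0 ≤ κ * ‖b‖ ^ 2 := by positivity
    have h2 : 0 ≤ κ * ‖b - gradY f xp yp‖ ^ 2 := by positivity
    have h3 : 0 ≤ κ * (ℓ ^ 2 * ‖rx‖ ^ 2) := by positivity
    have h4 : 0 ≤ κ * (ℓ ^ 2 * ‖ry‖ ^ 2) := by positivity
    have h5 := sq_nonneg ‖a‖
    have h6 := sq_nonneg ‖v‖
    linarith
  have key' := mul_le_mul_of_nonneg_left key hηx.le
  have k3' := mul_le_mul_of_nonneg_left k3 hηx.le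
  have e1 : ηx * (κ / 2 * ℓ ^ 2 * (ηx ^ 2 * (‖v - a‖ ^ 2 + 2 * inner ℝ (v - a) ex + ‖ex‖ ^ 2)
      + ηy ^ 2 * (‖w - b‖ ^ 2 + 2 * inner ℝ (w - b) ey + ‖ey‖ ^ 2)))
      = ηx * (1 / 2 * (κ * (ℓ ^ 2 * (ηx ^ 2 * ‖v - a‖ ^ 2))))
        + ηx * κ * ℓ ^ 2 * ηx ^ 2 * inner ℝ (v - a) ex
        + 1 / 2 * (ηx * (κ * (ℓ ^ 2 * (ηx ^ 2 * ‖ex‖ ^ 2))))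
        + ηx * (κ / 72) * (‖w - b‖ ^ 2 + 2 * inner ℝ (w - b) ey + ‖ey‖ ^ 2) := by
    linear_combination ηx * (κ / 2) * (‖w - b‖ ^ 2 + 2 * inner ℝ (w - b) ey + ‖ey‖ ^ 2) * hηy
  rw [mul_add ηx, mul_add ηx, e1]
  simp only [inner_add_left, real_inner_smul_left]
  have h7 : 0 ≤ ηx * κ * ‖ey‖ ^ 2 := by positivity
  have h8 : 0 ≤ ηx * ‖ex‖ ^ 2 := by positivity
  linarith

lemma IsStep.dualWeight_mul_sq_mul (h : IsStep ℓ κ c 6 ηx ηy) (r : ℝ) :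
    dualWeight ℓ κ 6 ηx * (ηy ^ 2 * r) = 1 / 21 * (ηx * κ * r) := by
  rw [← mul_assoc, h.dualWeight_mul_sq]; ring

lemma dualWeight_mul_init (ℓ κ ηx D : ℝ) : dualWeight ℓ κ 6 ηx * (22 * (74 / 36 * D))
    = 12 / 7 * 22 * (74 / 36) * (ηx * (κ * ℓ ^ 2 * D)) := by
  rw [dualWeight]; ring

/-- Initial gradient norms are of order `κℓΔ`, which is only a fraction `c/κ` of the term allowed in
the iteration count. -/
lemma IsStep.κ_mul_ℓ_mul_le (h : IsStep ℓ κ c 6 ηx ηy) {Δ : ℝ} (hΔ : 0 ≤ Δ) :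
    κ * ℓ * Δ ≤ 1 / 50 * (κ ^ 2 * ℓ * Δ / c) := by
  have hκ1 := h.one_le_κ
  have hκ0 := h.κ_pos
  have hℓ := h.ℓ_pos
  rw [← mul_div_assoc, le_div_iff₀ h.c_pos]
  have h1 : κ * ℓ * Δ * c ≤ κ * ℓ * Δ * (1 / 50) :=
    mul_le_mul_of_nonneg_left h.c_le (by positivity)
  have h2 : κ * (ℓ * Δ) ≤ κ ^ 2 * (ℓ * Δ) :=
    mul_le_mul_of_nonneg_right (by nlinarith) (by positivity)
  linarith

lemma IsStep.eq_ηx_mul (h : IsStep ℓ κ c 6 ηx ηy) (Δ : ℝ) : Δ = ηx * (κ ^ 2 * ℓ * Δ / c) := by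
  have := h.c_pos.ne'
  have := h.κ_pos.ne'
  have := h.ℓ_pos.ne'
  rw [h.ηx_eq]; field_simp

/-- The potential after the first minibatch, with its noise explicit. -/
lemma IsProblem.exists_ogda_init (hf : IsProblem f ℓ μ κ) (h : IsStep ℓ κ c 6 ηx ηy)
    (hb : BddBelow (Set.range (primal f))) {x₀ x₁ : Vec m} {y₀ y₁ : Vec n} {Δ D : ℝ}
    (hΔ₀ : primal f x₀ - (⨅ x, primal f x) ≤ Δ) (hΔ₁ : primal f x₁ - (⨅ x, primal f x) ≤ Δ)
    (hDx : ‖x₁ - x₀‖ ^ 2 ≤ D) (hDy : ‖y₁ - y₀‖ ^ 2 ≤ D) (hD₁ : ‖y₁ - argmaxY f x₁‖ ^ 2 ≤ D)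
    (hD₀ : ‖y₀ - argmaxY f x₀‖ ^ 2 ≤ D) :
    ∃ (bx : Vec m) (b_y : Vec n), ∀ (ex : Vec m) (ey : Vec n),
      ogdaPotential f ℓ κ ηx ηy ((x₀, y₀), (gradX f x₀ y₀ + ex, gradY f x₀ y₀ + ey), (x₁, y₁))
      ≤ ηx * (100 * (κ ^ 2 * ℓ * Δ / c + κ * ℓ ^ 2 * D))
        + inner ℝ bx ex + inner ℝ b_y ey
        + ηx * (3 / 50) * ‖ex‖ ^ 2 + ηx * (κ * (19 / 125)) * ‖ey‖ ^ 2 := by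
  have hηx := h.ηx_pos
  have hκ1 := h.one_le_κ
  have hκ0 := h.κ_pos
  have hℓ := h.ℓ_pos
  have hW := h.dualWeight_pos
  set v := gradX f x₀ y₀ with hv
  set w := gradY f x₀ y₀ with hw
  set G := gradient (primal f) x₁ with hG
  -- All the `‖a‖²` terms together have coefficient at most `57/1000` of `ηx`, whence the cross
  -- term. The dual linear part is zero because Young's inequality below separates `ey` completely.
  refine ⟨ηx • G + (ηx * (57 / 500)) • v, 0, fun ex ey => ?_⟩
  have hηy := h.sq_ℓ_mul_sq_ηy
  have hD : 0 ≤ D := (sq_nonneg _).trans hDx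
  have hN₁ : ‖G‖ ^ 2 ≤ 6 * κ * ℓ * Δ :=
    (sq_gradient_primal_le hf.ℓ_pos hf.μ_pos hf.κ_eq hκ1 hf.smooth hf.conc hb x₁).trans
      (mul_le_mul_of_nonneg_left hΔ₁ (by positivity))
  have hN₀ : ‖gradient (primal f) x₀‖ ^ 2 ≤ 6 * κ * ℓ * Δ :=
    (sq_gradient_primal_le hf.ℓ_pos hf.μ_pos hf.κ_eq hκ1 hf.smooth hf.conc hb x₀).trans
      (mul_le_mul_of_nonneg_left hΔ₀ (by positivity))
  have hℓD := mul_le_mul_of_nonneg_left hD₀ (sq_nonneg ℓ)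
  have hV : ‖v‖ ^ 2 ≤ 12 * κ * ℓ * Δ + 2 * (ℓ ^ 2 * D) := by
    have h1 := hf.smooth.sq_gradX_sub_le x₀ x₀ y₀ (argmaxY f x₀)
    rw [← hv, ← gradient_primal hf.ℓ_pos hf.μ_pos hf.κ_eq hf.smooth hf.conc, sub_self,
      norm_zero] at h1
    have h2 := sq_norm_add_le_mul (v - gradient (primal f) x₀) (gradient (primal f) x₀) one_pos
    rw [sub_add_cancel] at h2
    linarith
  have hw2 : ηy ^ 2 * ‖w‖ ^ 2 ≤ 1 / 36 * D := by
    have h1 := hf.smooth.sq_gradY_sub_le x₀ x₀ y₀ (argmaxY f x₀)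
    rw [← hw, gradY_argmaxY hf.μ_pos hf.smooth hf.conc, sub_self, norm_zero, sub_zero] at h1
    have h2 := mul_le_mul_of_nonneg_left (h1.trans (by linarith : _ ≤ ℓ ^ 2 * D)) (sq_nonneg ηy)
    have h3 : ηy ^ 2 * (ℓ ^ 2 * D) = 1 / 36 * D := by linear_combination D * hηy
    linarith
  unfold ogdaPotential
  simp only
  rw [show w + ey - w = ey from add_sub_cancel_left _ _]
  set a := v + ex with ha
  have F1 : primal f (x₁ + ηx • a) ≤ primal f x₁ + ηx * inner ℝ G a
      + 3 / 100 * ηx * ‖a‖ ^ 2 := by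
    have h1 := primal_le_add hf.ℓ_pos hf.μ_pos hf.κ_eq hκ1 hf.smooth hf.conc x₁ (ηx • a)
    rw [inner_smul_right, sq_norm_smul] at h1
    have := mul_le_mul_of_nonneg_right h.descent_coeff_le (sq_nonneg ‖a‖)
    linarith
  have F2 : inner ℝ G v ≤ 1 / 2 * ‖G‖ ^ 2 + 1 / 2 * ‖v‖ ^ 2 := by
    have h1 := sq_nonneg ‖G - v‖
    rw [norm_sub_sq_real] at h1
    linarith
  have F3 : ‖y₁ - ηy • (w + ey) - argmaxY f (x₁ + ηx • a)‖ ^ 2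
      ≤ 11 / 10 * (ηy ^ 2 * ‖ey‖ ^ 2) + 22 * (74 / 36 * D) + 22 * (κ ^ 2 * ηx ^ 2 * ‖a‖ ^ 2) := by
    have h1 := sq_norm_add_le_mul (-(ηy • ey)) ((y₁ - argmaxY f x₁ + -(ηy • w))
      + (argmaxY f x₁ - argmaxY f (x₁ + ηx • a))) (by norm_num : (0 : ℝ) < 1 / 10)
    have h2 := sq_norm_add_le_mul (y₁ - argmaxY f x₁ + -(ηy • w))
      (argmaxY f x₁ - argmaxY f (x₁ + ηx • a)) one_pos
    have h3 := sq_norm_add_le_mul (y₁ - argmaxY f x₁) (-(ηy • w)) one_pos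
    have h4 := sq_argmaxY_sub_le hf.ℓ_pos hf.μ_pos hf.κ_eq hf.smooth hf.conc x₁ (x₁ + ηx • a)
    rw [sub_add_cancel_left, norm_neg, sq_norm_smul] at h4
    rw [norm_neg, sq_norm_smul] at h1 h3
    rw [show -(ηy • ey) + ((y₁ - argmaxY f x₁ + -(ηy • w))
      + (argmaxY f x₁ - argmaxY f (x₁ + ηx • a)))
      = y₁ - ηy • (w + ey) - argmaxY f (x₁ + ηx • a) by module] at h1
    linarith
  have F4 : ‖x₁ + ηx • a - x₀‖ ^ 2 ≤ 2 * D + 2 * (ηx ^ 2 * ‖a‖ ^ 2) := by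
    have h1 := sq_norm_add_le_mul (x₁ - x₀) (ηx • a) one_pos
    rw [sq_norm_smul, show x₁ - x₀ + ηx • a = x₁ + ηx • a - x₀ by abel] at h1
    linarith
  have F5 : ‖y₁ - ηy • (w + ey) - y₀‖ ^ 2 ≤ 11 / 10 * (ηy ^ 2 * ‖ey‖ ^ 2) + 11 * (74 / 36 * D) := by
    have h1 := sq_norm_add_le_mul (-(ηy • ey)) (y₁ - y₀ + -(ηy • w))
      (by norm_num : (0 : ℝ) < 1 / 10)
    have h2 := sq_norm_add_le_mul (y₁ - y₀) (-(ηy • w)) one_pos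
    rw [norm_neg, sq_norm_smul] at h1 h2
    rw [show -(ηy • ey) + (y₁ - y₀ + -(ηy • w)) = y₁ - ηy • (w + ey) - y₀ by
      module] at h1
    linarith
  have F3' := mul_le_mul_of_nonneg_left F3 hW.le
  have F6 : dualWeight ℓ κ 6 ηx * (κ ^ 2 * ηx ^ 2 * ‖a‖ ^ 2) ≤ 7 / 9700 * ηx * ‖a‖ ^ 2 := by
    have h1 := mul_le_mul_of_nonneg_right h.dualWeight_drift_le (sq_nonneg ‖a‖)
    have h2 : 0 ≤ (κ - 1) * (dualWeight ℓ κ 6 ηx * (κ ^ 2 * ηx ^ 2 * ‖a‖ ^ 2)) :=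
      mul_nonneg (by linarith) (by positivity)
    linarith
  have F7 := h.dualWeight_mul_sq_mul (‖ey‖ ^ 2)
  have F8 := dualWeight_mul_init ℓ κ ηx D
  have F9 := mul_le_mul_of_nonneg_left (add_le_add F4 F5) (by positivity : 0 ≤ κ / 2 * ℓ ^ 2)
  have F10 : κ / 2 * ℓ ^ 2 * (11 / 10 * (ηy ^ 2 * ‖ey‖ ^ 2)) = 11 / 720 * (κ * ‖ey‖ ^ 2) := by
    linear_combination κ / 2 * (11 / 10) * ‖ey‖ ^ 2 * hηy
  have k1 := h.κ_mul_le (sq_nonneg ‖a‖)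
  have F11 : ‖a‖ ^ 2 = ‖v‖ ^ 2 + 2 * inner ℝ v ex + ‖ex‖ ^ 2 := sq_norm_add_eq v ex
  have F12 : inner ℝ G a = inner ℝ G v + inner ℝ G ex := by rw [ha, inner_add_right]
  have hΔ : 0 ≤ Δ := (sub_nonneg.2 (ciInf_le hb x₀)).trans hΔ₀
  have F13 := h.κ_mul_ℓ_mul_le hΔ
  have F14 : ℓ ^ 2 * D ≤ κ * ℓ ^ 2 * D := by
    rw [mul_assoc]; exact le_mul_of_one_le_left (by positivity) hκ1
  have F15 := h.eq_ηx_mul Δ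
  have hX : 0 ≤ κ ^ 2 * ℓ * Δ / c := div_nonneg (by positivity) h.c_pos.le
  have F9' := mul_le_mul_of_nonneg_left F9 hηx.le
  have k1' := mul_le_mul_of_nonneg_left k1 hηx.le
  have F2' := mul_le_mul_of_nonneg_left F2 hηx.le
  have hN₁' := mul_le_mul_of_nonneg_left hN₁ hηx.le
  have hV' := mul_le_mul_of_nonneg_left hV hηx.le
  have F13' := mul_le_mul_of_nonneg_left F13 hηx.le
  have F14' := mul_le_mul_of_nonneg_left F14 hηx.le
  have hX' : 0 ≤ ηx * (κ ^ 2 * ℓ * Δ / c) := by positivity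
  have hD' : 0 ≤ ηx * (κ * ℓ ^ 2 * D) := by positivity
  have hE' : 0 ≤ ηx * κ * ‖ey‖ ^ 2 := by positivity
  have hE2 : 0 ≤ ηx * ‖ex‖ ^ 2 := by positivity
  have hA : 0 ≤ ηx * ‖a‖ ^ 2 := by positivity
  have F11' : ηx * ‖a‖ ^ 2 = ηx * (‖v‖ ^ 2 + 2 * inner ℝ v ex + ‖ex‖ ^ 2) := by rw [F11]
  have F10' : ηx * (κ / 2 * ℓ ^ 2 * (11 / 10 * (ηy ^ 2 * ‖ey‖ ^ 2)))
      = ηx * (11 / 720 * (κ * ‖ey‖ ^ 2)) := by rw [F10]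
  rw [F12] at F1
  simp only [inner_add_left, real_inner_smul_left, inner_zero_left]
  generalize κ ^ 2 * ℓ * Δ / c = X at *
  generalize dualWeight ℓ κ 6 ηx = W at *
  linarith

section Expectation

variable {Mx My : ℕ} {Ξx Ξy Ω : Type*} [MeasurableSpace Ξx] [MeasurableSpace Ξy]
  [MeasurableSpace Ω] {P : Measure Ω} [IsProbabilityMeasure P] {νx : Measure Ξx} {νy : Measure Ξy}
  {Gx : Vec m → Vec n → Ξx → Vec m} {Gy : Vec m → Vec n → Ξy → Vec n} {σ ε : ℝ}
  {ξx : ℕ → Fin Mx → Ω → Ξx} {ξy : ℕ → Fin My → Ω → Ξy}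

/-- The state of OGDA before round `t + 1`. -/
def ogdaState (Gx : Vec m → Vec n → Ξx → Vec m) (Gy : Vec m → Vec n → Ξy → Vec n) (ηx ηy : ℝ)
    (p₀ p₁ : Vec m × Vec n) (s : ℕ → (Fin Mx → Ξx) × (Fin My → Ξy)) (t : ℕ) : OgdaState m n :=
  (ogda Gx Gy ηx ηy p₀ p₁ s t, minibatchPair Gx Gy (s t) (ogda Gx Gy ηx ηy p₀ p₁ s t),
    ogda Gx Gy ηx ηy p₀ p₁ s (t + 1))

lemma measurable_ogdaNext_minibatchPair {gx : Vec m → Vec n → Vec m} {gy : Vec m → Vec n → Vec n}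
    (hGx : IsStochasticOracle νx gx Gx σ) (hGy : IsStochasticOracle νy gy Gy σ)
    {Ω' : Type*} {mΩ' : MeasurableSpace Ω'} {p q : Ω' → Vec m × Vec n}
    {r r' : Ω' → (Fin Mx → Ξx) × (Fin My → Ξy)} (hp : Measurable p) (hq : Measurable q)
    (hr : Measurable r) (hr' : Measurable r') :
    Measurable fun ω => ogdaNext ηx ηy (q ω) (minibatchPair Gx Gy (r ω) (p ω))
      (minibatchPair Gx Gy (r' ω) (q ω)) := by
  have hmb := measurable_minibatchPair (Mx := Mx) (My := My) hGx hGy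
  have h1 := hmb.comp (hp.prodMk hr)
  have h2 := hmb.comp (hq.prodMk hr')
  exact (continuous_ogdaNext ηx ηy).measurable.comp (hq.prodMk (h1.prodMk h2))

lemma measurable_ogda {gx : Vec m → Vec n → Vec m} {gy : Vec m → Vec n → Vec n}
    (hGx : IsStochasticOracle νx gx Gx σ) (hGy : IsStochasticOracle νy gy Gy σ)
    (p₀ p₁ : Vec m × Vec n) {Ω' : Type*} {mΩ' : MeasurableSpace Ω'}
    {s : Ω' → ℕ → (Fin Mx → Ξx) × (Fin My → Ξy)} (t : ℕ)
    (hs : ∀ i < t, Measurable fun ω => s ω i) :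
    Measurable fun ω => ogda Gx Gy ηx ηy p₀ p₁ (s ω) t := by
  induction t using Nat.twoStepInduction with
  | zero => exact measurable_const
  | one => exact measurable_const
  | more t ih1 ih2 =>
    have h1 := ih1 fun i hi => hs i (by omega)
    have h2 := ih2 fun i hi => hs i (by omega)
    exact measurable_ogdaNext_minibatchPair hGx hGy h1 h2 (hs t (by omega))
      (hs (t + 1) (by omega))

lemma measurable_ogdaState {gx : Vec m → Vec n → Vec m} {gy : Vec m → Vec n → Vec n}
    (hGx : IsStochasticOracle νx gx Gx σ) (hGy : IsStochasticOracle νy gy Gy σ)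
    (p₀ p₁ : Vec m × Vec n) {Ω' : Type*} {mΩ' : MeasurableSpace Ω'}
    {s : Ω' → ℕ → (Fin Mx → Ξx) × (Fin My → Ξy)} (t : ℕ)
    (hs : ∀ i < t + 1, Measurable fun ω => s ω i) :
    Measurable fun ω => ogdaState Gx Gy ηx ηy p₀ p₁ (s ω) t := by
  have h1 := measurable_ogda (ηx := ηx) (ηy := ηy) hGx hGy p₀ p₁ t
    fun i hi => hs i (hi.trans (Nat.lt_succ_self t))
  have h2 := measurable_ogda (ηx := ηx) (ηy := ηy) hGx hGy p₀ p₁ (t + 1) hs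
  exact h1.prodMk (((measurable_minibatchPair hGx hGy).comp
    (h1.prodMk (hs t (Nat.lt_succ_self t)))).prodMk h2)

variable [IsProbabilityMeasure νx] [IsProbabilityMeasure νy]

lemma lintegral_ogdaPotential_le (hf : IsProblem f ℓ μ κ) (h : IsStep ℓ κ c 6 ηx ηy)
    (hb : BddBelow (Set.range (primal f))) (hξ : IsSampling P νx νy ξx ξy)
    (hGx : IsStochasticOracle νx (gradX f) Gx σ) (hGy : IsStochasticOracle νy (gradY f) Gy σ)
    (hMx : 0 < Mx) (hMy : 0 < My) (hσx : σ ^ 2 / Mx ≤ ε ^ 2) (hσy : κ * (σ ^ 2 / My) ≤ ε ^ 2)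
    (k : ℕ) (z : OgdaState m n) :
    ∫⁻ ω, (ENNReal.ofReal (ogdaPotential f ℓ κ ηx ηy (z.2.2,
        minibatchPair Gx Gy (allSamples ξx ξy ω k) z.2.2,
        ogdaNext ηx ηy z.2.2 z.2.1 (minibatchPair Gx Gy (allSamples ξx ξy ω k) z.2.2)))
      + ENNReal.ofReal (ηx * (10 / 21) * ‖gradient (primal f) z.2.2.1‖ ^ 2)) ∂P
      ≤ ENNReal.ofReal (ogdaPotential f ℓ κ ηx ηy z)
        + ENNReal.ofReal (ηx * (258 / 1000 * ε ^ 2)) := by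
  have hκ0 := h.κ_pos; have hηx := h.ηx_pos
  obtain ⟨bx, b_y, hstep⟩ := hf.exists_ogda_step h z
  have H := hξ.lintegral_le hGx hGy hMx hMy
    (R := fun ex ey => ogdaPotential f ℓ κ ηx ηy (z.2.2,
        (gradX f z.2.2.1 z.2.2.2 + ex, gradY f z.2.2.1 z.2.2.2 + ey),
        ogdaNext ηx ηy z.2.2 z.2.1
          (gradX f z.2.2.1 z.2.2.2 + ex, gradY f z.2.2.1 z.2.2.2 + ey)))
    (A := ogdaPotential f ℓ κ ηx ηy z - ηx * (10 / 21) * ‖gradient (primal f) z.2.2.1‖ ^ 2)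
    (kx := ηx * (111 / 1000)) (ky := ηx * (κ * (147 / 1000))) (bx := bx) (b_y := b_y)
    (fun _ _ => ogdaPotential_nonneg h hb _) (by positivity) (by positivity) hstep k z.2.2
  simp only [add_minibatchError] at H
  have hN : 0 ≤ ηx * (10 / 21) * ‖gradient (primal f) z.2.2.1‖ ^ 2 := by positivity
  rw [lintegral_add_right _ measurable_const, lintegral_const, measure_univ, mul_one]
  refine (add_le_add H.2 le_rfl).trans ?_
  rw [← ENNReal.ofReal_add H.1 hN, ← ENNReal.ofReal_add (ogdaPotential_nonneg h hb z)
    (by positivity)]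
  refine ENNReal.ofReal_le_ofReal ?_
  have h2 := mul_le_mul_of_nonneg_left hσx hηx.le
  have h3 := mul_le_mul_of_nonneg_left hσy hηx.le
  linarith

lemma ogda_descent (hf : IsProblem f ℓ μ κ) (h : IsStep ℓ κ c 6 ηx ηy)
    (hb : BddBelow (Set.range (primal f))) (hξ : IsSampling P νx νy ξx ξy)
    (hGx : IsStochasticOracle νx (gradX f) Gx σ) (hGy : IsStochasticOracle νy (gradY f) Gy σ)
    (hMx : 0 < Mx) (hMy : 0 < My) (hσx : σ ^ 2 / Mx ≤ ε ^ 2) (hσy : κ * (σ ^ 2 / My) ≤ ε ^ 2)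
    (p₀ p₁ : Vec m × Vec n) (t : ℕ) :
    ∫⁻ ω, ENNReal.ofReal (ogdaPotential f ℓ κ ηx ηy
        (ogdaState Gx Gy ηx ηy p₀ p₁ (allSamples ξx ξy ω) (t + 1))) ∂P
      + ∫⁻ ω, ENNReal.ofReal (ηx * (10 / 21) *
        ‖gradient (primal f) (ogda Gx Gy ηx ηy p₀ p₁ (allSamples ξx ξy ω) (t + 1)).1‖ ^ 2) ∂P
      ≤ ∫⁻ ω, ENNReal.ofReal (ogdaPotential f ℓ κ ηx ηy
        (ogdaState Gx Gy ηx ηy p₀ p₁ (allSamples ξx ξy ω) t)) ∂P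
        + ENNReal.ofReal (ηx * (258 / 1000 * ε ^ 2)) := by
  have hz : Measurable[past ξx ξy (t + 1)]
      fun ω => ogdaState Gx Gy ηx ηy p₀ p₁ (allSamples ξx ξy ω) t :=
    measurable_ogdaState hGx hGy p₀ p₁ t fun i hi => measurable_past_round hi
  have hmb := measurable_minibatchPair (Mx := Mx) (My := My) hGx hGy
  have hnx := (continuous_ogdaNext (m := m) (n := n) ηx ηy).measurable
  have hpot := (hf.continuous_ogdaPotential (ηx := ηx) (ηy := ηy)).measurable
  have hgr := hf.continuous_gradient_primal.measurable
  have hmN : Measurable fun z : OgdaState m n =>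
      ENNReal.ofReal (ηx * (10 / 21) * ‖gradient (primal f) z.2.2.1‖ ^ 2) :=
    (((hgr.comp measurable_snd.snd.fst).norm.pow_const 2).const_mul _).ennreal_ofReal
  have hN : Measurable fun ω => ENNReal.ofReal (ηx * (10 / 21) * ‖gradient (primal f)
      (ogdaState Gx Gy ηx ηy p₀ p₁ (allSamples ξx ξy ω) t).2.2.1‖ ^ 2) :=
    hmN.comp (hz.mono (hξ.past_le _) le_rfl)
  have hg : Measurable fun q : OgdaState m n × ((Fin Mx → Ξx) × (Fin My → Ξy)) =>
      minibatchPair Gx Gy q.2 q.1.2.2 :=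
    hmb.comp (measurable_fst.snd.snd.prodMk measurable_snd)
  have h2 := hξ.lintegral_le_of_forall hz
    (F := fun q => ENNReal.ofReal (ogdaPotential f ℓ κ ηx ηy (q.1.2.2,
        minibatchPair Gx Gy q.2 q.1.2.2,
        ogdaNext ηx ηy q.1.2.2 q.1.2.1 (minibatchPair Gx Gy q.2 q.1.2.2)))
      + ENNReal.ofReal (ηx * (10 / 21) * ‖gradient (primal f) q.1.2.2.1‖ ^ 2))
    (H := fun z => ENNReal.ofReal (ogdaPotential f ℓ κ ηx ηy z)
      + ENNReal.ofReal (ηx * (258 / 1000 * ε ^ 2)))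
    ((hpot.comp (measurable_fst.snd.snd.prodMk (hg.prodMk (hnx.comp
      (measurable_fst.snd.snd.prodMk (measurable_fst.snd.fst.prodMk hg)))))).ennreal_ofReal.add
      (hmN.comp measurable_fst))
    fun z => lintegral_ogdaPotential_le hf h hb hξ hGx hGy hMx hMy hσx hσy _ z
  rw [lintegral_add_right _ hN, lintegral_add_right _ measurable_const,
    lintegral_const, measure_univ, mul_one] at h2
  exact h2

theorem ogda_output (hf : IsProblem f ℓ μ κ) (h : IsStep ℓ κ c 6 ηx ηy)
    (hb : BddBelow (Set.range (primal f))) (hξ : IsSampling P νx νy ξx ξy)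
    (hGx : IsStochasticOracle νx (gradX f) Gx σ) (hGy : IsStochasticOracle νy (gradY f) Gy σ)
    (hMx : 0 < Mx) (hMy : 0 < My) (hσx : σ ^ 2 / Mx ≤ ε ^ 2) (hσy : κ * (σ ^ 2 / My) ≤ ε ^ 2)
    {x₀ x₁ : Vec m} {y₀ y₁ : Vec n} {Δ D : ℝ}
    (hΔ₀ : primal f x₀ - (⨅ x, primal f x) ≤ Δ) (hΔ₁ : primal f x₁ - (⨅ x, primal f x) ≤ Δ)
    (hDx : ‖x₁ - x₀‖ ^ 2 ≤ D) (hDy : ‖y₁ - y₀‖ ^ 2 ≤ D) (hD₁ : ‖y₁ - argmaxY f x₁‖ ^ 2 ≤ D)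
    (hD₀ : ‖y₀ - argmaxY f x₀‖ ^ 2 ≤ D) {T : ℕ} (hT0 : 0 < T)
    (hT : 20000 * (κ ^ 2 * ℓ * Δ / c + κ * ℓ ^ 2 * D) ≤ T * ε ^ 2)
    {τ : Ω → ℕ} (hτ : IsUniformIndex P (Finset.Icc 1 T) (allSamples ξx ξy) τ) :
    Integrable (fun ω => ‖gradient (primal f)
      (ogda Gx Gy ηx ηy (x₀, y₀) (x₁, y₁) (allSamples ξx ξy ω) (τ ω)).1‖ ^ 2) P ∧
    ∫ ω, ‖gradient (primal f)
      (ogda Gx Gy ηx ηy (x₀, y₀) (x₁, y₁) (allSamples ξx ξy ω) (τ ω)).1‖ ^ 2 ∂P ≤ ε ^ 2 := by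
  have hηx := h.ηx_pos
  have hκ0 := h.κ_pos
  have hgr := hf.continuous_gradient_primal.measurable
  refine hτ.integral_le
    (F := fun t s => ‖gradient (primal f) (ogda Gx Gy ηx ηy (x₀, y₀) (x₁, y₁) s t).1‖ ^ 2)
    (measurable_pi_lambda _ hξ.measurable_round) (Finset.nonempty_Icc.2 hT0) (fun t => ?_)
    (fun _ _ => by positivity) (by positivity : 0 < ηx * (10 / 21)) ?_
  · have h1 : Measurable fun s : ℕ → (Fin Mx → Ξx) × (Fin My → Ξy) =>
        ogda Gx Gy ηx ηy (x₀, y₀) (x₁, y₁) s t :=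
      measurable_ogda hGx hGy _ _ t fun i _ => measurable_pi_apply i
    exact (hgr.comp h1.fst).norm.pow_const 2
  · have h1 := sum_le_of_descent
      (ogda_descent hf h hb hξ hGx hGy hMx hMy hσx hσy (x₀, y₀) (x₁, y₁)) T
    have hsum : ∀ L : ℕ → ENNReal, ∑ t ∈ Finset.Icc 1 T, L t
        = ∑ t ∈ Finset.range T, L (t + 1) := fun L => by
      rw [Finset.range_eq_Ico, Finset.sum_Ico_add' L 0 T 1, zero_add]; rfl
    rw [hsum]
    refine (le_add_self.trans h1).trans ?_
    obtain ⟨bx, b_y, hinit⟩ := hf.exists_ogda_init h hb hΔ₀ hΔ₁ hDx hDy hD₁ hD₀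
    have H := hξ.lintegral_le hGx hGy hMx hMy
      (R := fun ex ey => ogdaPotential f ℓ κ ηx ηy
        ((x₀, y₀), (gradX f x₀ y₀ + ex, gradY f x₀ y₀ + ey), (x₁, y₁)))
      (A := ηx * (100 * (κ ^ 2 * ℓ * Δ / c + κ * ℓ ^ 2 * D)))
      (kx := ηx * (3 / 50)) (ky := ηx * (κ * (19 / 125))) (bx := bx) (b_y := b_y)
      (fun _ _ => ogdaPotential_nonneg h hb _) (by positivity) (by positivity) hinit 0 (x₀, y₀)
    simp only [fun ξ => add_minibatchError (gradX f) Gx ξ (x₀, y₀),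
      fun ξ => add_minibatchError (gradY f) Gy ξ (x₀, y₀)] at H
    refine (add_le_add H.2 le_rfl).trans ?_
    rw [← ENNReal.ofReal_natCast T, ← ENNReal.ofReal_mul (Nat.cast_nonneg T),
      ← ENNReal.ofReal_add H.1 (by positivity)]
    refine ENNReal.ofReal_le_ofReal ?_
    rw [Nat.card_Icc, Nat.add_sub_cancel]
    have hT1 : (1 : ℝ) ≤ T := by exact_mod_cast hT0
    have h2 : ε ^ 2 ≤ T * ε ^ 2 := le_mul_of_one_le_left (sq_nonneg ε) hT1
    -- The noise of the starting round is charged to one of the `T ≥ 1` iterations. The constant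
    -- `20000` comes from the slack `10/21 - 258/1000 - 3/50 - 19/125`, slightly above `100/20000`.
    have h3 : 100 * (κ ^ 2 * ℓ * Δ / c + κ * ℓ ^ 2 * D) + 3 / 50 * (σ ^ 2 / Mx)
        + 19 / 125 * (κ * (σ ^ 2 / My)) + T * (258 / 1000 * ε ^ 2) ≤ 10 / 21 * (T * ε ^ 2) := by
      have : 0 ≤ T * ε ^ 2 := by positivity
      linarith
    have h4 := mul_le_mul_of_nonneg_left h3 hηx.le
    linarith

end Expectation

end OptimisticGradient

/-! ### Rounding of batch sizes and iteration counts. -/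

section Complexity

lemma batchSize_pos (r : ℝ) : 0 < batchSize r :=
  Nat.ceil_pos.2 (one_pos.trans_le (le_max_left _ _))

lemma le_batchSize (r : ℝ) : r ≤ batchSize r :=
  (le_max_right _ _).trans (Nat.le_ceil _)

lemma batchSize_le {r : ℝ} (hr : 0 ≤ r) : (batchSize r : ℝ) ≤ 2 + r := by
  have h1 := Nat.ceil_lt_add_one (zero_le_one.trans (le_max_left 1 r))
  have h2 : max 1 r ≤ 1 + r := max_le (by linarith) (by linarith)
  unfold batchSize
  linarith

lemma mul_div_batchSize_le {a σ ε : ℝ} (hε : 0 < ε) :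
    a * (σ ^ 2 / batchSize (a * σ ^ 2 / ε ^ 2)) ≤ ε ^ 2 := by
  have h1 : (0 : ℝ) < batchSize (a * σ ^ 2 / ε ^ 2) := Nat.cast_pos.2 (batchSize_pos _)
  have h2 := le_batchSize (a * σ ^ 2 / ε ^ 2)
  rw [div_le_iff₀ (by positivity)] at h2
  rw [← mul_div_assoc, div_le_iff₀ h1, mul_comm (ε ^ 2)]
  exact h2

lemma batchSize_le_mul {a κ σ ε : ℝ} (ha : 0 ≤ a) (haκ : a ≤ κ) (hκ : 1 ≤ κ) (hε : 0 < ε)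
    (hε1 : ε ≤ 1) : (batchSize (a * σ ^ 2 / ε ^ 2) : ℝ) ≤ 2 * (κ * (1 + σ ^ 2) / ε ^ 2) := by
  have hε2 : ε ^ 2 ≤ 1 := pow_le_one₀ hε.le hε1
  refine (batchSize_le (by positivity)).trans ?_
  rw [← mul_div_assoc, le_div_iff₀ (by positivity), add_mul,
    div_mul_cancel₀ _ (pow_pos hε 2).ne']
  have h1 := mul_le_mul_of_nonneg_right haκ (sq_nonneg σ)
  have h2 : 0 ≤ κ * σ ^ 2 := by positivity
  linarith

lemma iterationCount_pos (r : ℝ) : 0 < iterationCount r :=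
  Nat.one_pos.trans_le (le_max_left _ _)

lemma le_iterationCount (r : ℝ) : r ≤ iterationCount r :=
  (Nat.le_ceil r).trans (Nat.cast_le.2 (le_max_right _ _))

lemma iterationCount_le {r : ℝ} (hr : 0 ≤ r) : (iterationCount r : ℝ) ≤ 1 + r := by
  have h1 := Nat.ceil_lt_add_one hr
  unfold iterationCount
  rw [Nat.cast_max, Nat.cast_one]
  exact max_le (by linarith) (by linarith)

lemma mul_le_of_iterationCount_le {C X ε : ℝ} (hε : 0 < ε) {T : ℕ}
    (hT : iterationCount (C * (X / ε ^ 2)) ≤ T) : C * X ≤ T * ε ^ 2 := by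
  have h1 := (le_iterationCount (C * (X / ε ^ 2))).trans (Nat.cast_le.2 hT)
  rwa [← mul_div_assoc, div_le_iff₀ (by positivity)] at h1

/-- The order `κ²/ε²` of the iteration count times the order `κ/ε²` of a batch; the rounding of the
count is absorbed since `κ²/ε² ≥ 1`. -/
lemma iterationCount_mul_le {C κ ℓ Δ c D σ ε N : ℝ} (hC : 0 ≤ C) (hκ : 1 ≤ κ) (hℓ : 0 < ℓ)
    (hΔ : 0 ≤ Δ) (hc : 0 < c) (hD : 0 ≤ D) (hε : 0 < ε) (hε1 : ε ≤ 1)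
    (hN : N ≤ 8 * (κ * (1 + σ ^ 2) / ε ^ 2)) :
    iterationCount (C * ((κ ^ 2 * ℓ * Δ / c + κ * ℓ ^ 2 * D) / ε ^ 2)) * N
      ≤ 8 * (1 + C) * (1 + ℓ * Δ / c + ℓ ^ 2 * D) * (1 + σ ^ 2) * (κ ^ 3 / ε ^ 4) := by
  have hκ0 : 0 < κ := by linarith
  have hε2 : ε ^ 2 ≤ 1 := pow_le_one₀ hε.le hε1
  have hκ2 : κ ≤ κ ^ 2 := by nlinarith
  have h1 : (iterationCount (C * ((κ ^ 2 * ℓ * Δ / c + κ * ℓ ^ 2 * D) / ε ^ 2)) : ℝ)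
      ≤ (1 + C) * κ ^ 2 * (1 + ℓ * Δ / c + ℓ ^ 2 * D) / ε ^ 2 := by
    refine (iterationCount_le (by positivity)).trans ?_
    rw [le_div_iff₀ (by positivity), add_mul, ← mul_div_assoc,
      div_mul_cancel₀ _ (pow_pos hε 2).ne',
      show κ ^ 2 * ℓ * Δ / c = κ ^ 2 * (ℓ * Δ / c) by ring]
    have hX : 0 ≤ ℓ * Δ / c := by positivity
    have hY : 0 ≤ ℓ ^ 2 * D := by positivity
    have h2 := mul_le_mul_of_nonneg_left (mul_le_mul_of_nonneg_right hκ2 hY) hC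
    have h3 : 0 ≤ κ ^ 2 * (ℓ * Δ / c) := by positivity
    have h4 : 0 ≤ κ ^ 2 * (ℓ ^ 2 * D) := by positivity
    have h5 : 0 ≤ C * κ ^ 2 := by positivity
    linarith
  calc _ ≤ (1 + C) * κ ^ 2 * (1 + ℓ * Δ / c + ℓ ^ 2 * D) / ε ^ 2
        * (8 * (κ * (1 + σ ^ 2) / ε ^ 2)) :=
        (mul_le_mul_of_nonneg_left hN (Nat.cast_nonneg _)).trans
          (mul_le_mul_of_nonneg_right h1 (by positivity))
    _ = _ := by field_simp

end Complexity

end Minimax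

end

theorem mainTheorem3 :
    ∃ C K : ℝ, 0 < C ∧ 0 < K ∧
    ∀ (m n : ℕ) (_hn : 0 < n) (f : Minimax.Vec m → Minimax.Vec n → ℝ) (ℓ μ κ σ ε : ℝ)
      (_hℓ : 0 < ℓ) (_hμ : 0 < μ) (_hκ : κ = ℓ / μ) (_hσ : 0 ≤ σ) (_hε : 0 < ε)
      (_hsmooth : Minimax.IsSmooth f ℓ) (_hconc : Minimax.IsStronglyConcave f μ)
      (_hbdd : BddBelow (Set.range (Minimax.primal f)))
      (Ξx Ξy : Type*) [MeasurableSpace Ξx] [MeasurableSpace Ξy]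
      (νx : Measure Ξx) (νy : Measure Ξy) [IsProbabilityMeasure νx] [IsProbabilityMeasure νy]
      (Gx : Minimax.Vec m → Minimax.Vec n → Ξx → Minimax.Vec m)
      (Gy : Minimax.Vec m → Minimax.Vec n → Ξy → Minimax.Vec n)
      (_hGx : Minimax.IsStochasticOracle νx (Minimax.gradX f) Gx σ)
      (_hGy : Minimax.IsStochasticOracle νy (Minimax.gradY f) Gy σ),
      -- the primal function is differentiable, so that its gradient is meaningful
      Differentiable ℝ (Minimax.primal f) ∧
      -- stochastic EG
      (∀ (c ηx ηy : ℝ) (_hc : 0 < c) (_hc' : c ≤ 1 / 75)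
        (_hηx : ηx = c / (κ ^ 2 * ℓ)) (_hηy : ηy = 1 / (4 * ℓ))
        (x₀ : Minimax.Vec m) (y₀ : Minimax.Vec n) (Δ D₀ : ℝ)
        (_hΔ : Δ = Minimax.primal f x₀ - ⨅ x, Minimax.primal f x)
        (_hD₀ : D₀ = ‖y₀ - Minimax.argmaxY f x₀‖ ^ 2)
        (M T₀ : ℕ) (_hM : M = Minimax.batchSize (κ * σ ^ 2 / ε ^ 2))
        (_hT₀ : T₀ = Minimax.iterationCount
          (C * ((κ ^ 2 * ℓ * Δ / c + κ * ℓ ^ 2 * D₀) / ε ^ 2))),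
        (∀ (Ω : Type*) [MeasurableSpace Ω] (P : Measure Ω) [IsProbabilityMeasure P]
          (ξx : ℕ → Fin M → Ω → Ξx) (ξy : ℕ → Fin M → Ω → Ξy)
          (_hξ : Minimax.IsSampling P νx νy ξx ξy)
          (T : ℕ) (_hT : T₀ ≤ T) (τ : Ω → ℕ)
          (_hτ : Minimax.IsUniformIndex P (Finset.range T) (Minimax.allSamples ξx ξy) τ)
          (xbar : Ω → Minimax.Vec m)
          (_hxbar : ∀ ω, xbar ω =
            (Minimax.eg Gx Gy ηx ηy (x₀, y₀) (Minimax.allSamples ξx ξy ω) (τ ω)).1),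
          Integrable (fun ω => ‖gradient (Minimax.primal f) (xbar ω)‖ ^ 2) P ∧
          ∫ ω, ‖gradient (Minimax.primal f) (xbar ω)‖ ^ 2 ∂P ≤ ε ^ 2) ∧
        (ε ≤ 1 → (Minimax.egOracleCalls M M T₀ : ℝ)
          ≤ K * (1 + ℓ * Δ / c + ℓ ^ 2 * D₀) * (1 + σ ^ 2) * (κ ^ 3 / ε ^ 4))) ∧
      -- stochastic OGDA
      (∀ (c ηx ηy : ℝ) (_hc : 0 < c) (_hc' : c ≤ 1 / 50)
        (_hηx : ηx = c / (κ ^ 2 * ℓ)) (_hηy : ηy = 1 / (6 * ℓ))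
        (x₀ x₁ : Minimax.Vec m) (y₀ y₁ : Minimax.Vec n) (Δ D₀ : ℝ)
        (_hΔ : Δ = max (Minimax.primal f x₁) (Minimax.primal f x₀) - ⨅ x, Minimax.primal f x)
        (_hD₀ : D₀ = max (max (‖x₁ - x₀‖ ^ 2) (‖y₁ - y₀‖ ^ 2))
          (max (‖y₁ - Minimax.argmaxY f x₁‖ ^ 2) (‖y₀ - Minimax.argmaxY f x₀‖ ^ 2)))
        (Mx My T₀ : ℕ) (_hMx : Mx = Minimax.batchSize (σ ^ 2 / ε ^ 2))
        (_hMy : My = Minimax.batchSize (κ * σ ^ 2 / ε ^ 2))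
        (_hT₀ : T₀ = Minimax.iterationCount
          (C * ((κ ^ 2 * ℓ * Δ / c + κ * ℓ ^ 2 * D₀) / ε ^ 2))),
        (∀ (Ω : Type*) [MeasurableSpace Ω] (P : Measure Ω) [IsProbabilityMeasure P]
          (ξx : ℕ → Fin Mx → Ω → Ξx) (ξy : ℕ → Fin My → Ω → Ξy)
          (_hξ : Minimax.IsSampling P νx νy ξx ξy)
          (T : ℕ) (_hT : T₀ ≤ T) (τ : Ω → ℕ)
          (_hτ : Minimax.IsUniformIndex P (Finset.Icc 1 T) (Minimax.allSamples ξx ξy) τ)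
          (xbar : Ω → Minimax.Vec m)
          (_hxbar : ∀ ω, xbar ω =
            (Minimax.ogda Gx Gy ηx ηy (x₀, y₀) (x₁, y₁) (Minimax.allSamples ξx ξy ω) (τ ω)).1),
          Integrable (fun ω => ‖gradient (Minimax.primal f) (xbar ω)‖ ^ 2) P ∧
          ∫ ω, ‖gradient (Minimax.primal f) (xbar ω)‖ ^ 2 ∂P ≤ ε ^ 2) ∧
        (ε ≤ 1 → (Minimax.ogdaOracleCalls Mx My T₀ : ℝ)
          ≤ K * (1 + ℓ * Δ / c + ℓ ^ 2 * D₀) * (1 + σ ^ 2) * (κ ^ 3 / ε ^ 4))) := by 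
  -- OGDA dictates `20000`, while EG needs only `6`. The `8` is four minibatches per EG iteration,
  -- each of size at most `2κ(1 + σ²)/ε²`; OGDA uses two.
  refine ⟨20000, 8 * (1 + 20000), by norm_num, by norm_num, ?_⟩
  intro m n hn f ℓ μ κ σ ε hℓ hμ hκ _ hε hs hc hb Ξx Ξy _ _ νx νy _ _ Gx Gy hGx hGy
  have hκ1 : 1 ≤ κ := by
    rw [hκ, one_le_div hμ]
    exact Minimax.le_of_isSmooth_of_isStronglyConcave hn hℓ hs hc
  have hκ0 : 0 ≤ κ := zero_le_one.trans hκ1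
  have hf : Minimax.IsProblem f ℓ μ κ := ⟨hℓ, hμ, hκ, hκ1, hs, hc⟩
  refine ⟨fun x => (Minimax.hasGradientAt_primal hℓ hμ hκ hs hc x).differentiableAt, ?_, ?_⟩
  · intro c ηx ηy hc0 hc1 hηx hηy x₀ y₀ Δ D₀ hΔ hD₀ M T₀ hM hT₀
    subst hΔ hD₀ hM hT₀
    have hΔ0 := sub_nonneg.2 (ciInf_le hb x₀)
    have h : Minimax.IsStep ℓ κ c 4 ηx ηy :=
      ⟨hℓ, hκ1, hc0, hc1.trans (by norm_num), le_rfl, by norm_num, hηx, hηy⟩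
    refine ⟨fun Ω _ P _ ξx ξy hξ T hT τ hτ xbar hxbar => ?_, fun hε1 => ?_⟩
    · rw [funext hxbar]
      refine Minimax.eg_output hf h hb hξ hGx hGy (Minimax.batchSize_pos _)
        (Minimax.mul_div_batchSize_le hε) (x₀, y₀) ((Minimax.iterationCount_pos _).trans_le hT)
        ((mul_le_mul_of_nonneg_right (by norm_num : (6 : ℝ) ≤ 20000) ?_).trans
          (Minimax.mul_le_of_iterationCount_le hε hT)) hτ
      positivity
    · have hM := Minimax.batchSize_le_mul (σ := σ) hκ0 le_rfl hκ1 hε hε1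
      refine le_of_eq_of_le ?_ (Minimax.iterationCount_mul_le (C := 20000) (by norm_num) hκ1 hℓ
        hΔ0 hc0 (sq_nonneg _) hε hε1 (by linarith :
          4 * (Minimax.batchSize (κ * σ ^ 2 / ε ^ 2) : ℝ) ≤ _))
      rw [Minimax.egOracleCalls, Finset.sum_const, Finset.card_range, smul_eq_mul]
      push_cast
      ring
  · intro c ηx ηy hc0 hc1 hηx hηy x₀ x₁ y₀ y₁ Δ D₀ hΔ hD₀ Mx My T₀ hMx hMy hT₀
    subst hMx hMy hT₀
    have hΔ₀ : Minimax.primal f x₀ - (⨅ x, Minimax.primal f x) ≤ Δ :=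
      hΔ ▸ sub_le_sub_right (le_max_right _ _) _
    have hΔ₁ : Minimax.primal f x₁ - (⨅ x, Minimax.primal f x) ≤ Δ :=
      hΔ ▸ sub_le_sub_right (le_max_left _ _) _
    have hD := hD₀.ge
    simp only [max_le_iff] at hD
    obtain ⟨⟨hDx, hDy⟩, hD1, hD0⟩ := hD
    have h : Minimax.IsStep ℓ κ c 6 ηx ηy :=
      ⟨hℓ, hκ1, hc0, hc1, by norm_num, le_rfl, hηx, hηy⟩
    refine ⟨fun Ω _ P _ ξx ξy hξ T hT τ hτ xbar hxbar => ?_, fun hε1 => ?_⟩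
    · rw [funext hxbar]
      have hσx := Minimax.mul_div_batchSize_le (a := 1) (σ := σ) hε
      rw [one_mul, one_mul] at hσx
      exact Minimax.ogda_output hf h hb hξ hGx hGy (Minimax.batchSize_pos _)
        (Minimax.batchSize_pos _) hσx (Minimax.mul_div_batchSize_le hε) hΔ₀ hΔ₁ hDx hDy hD1 hD0
        ((Minimax.iterationCount_pos _).trans_le hT) (Minimax.mul_le_of_iterationCount_le hε hT) hτ
    · have hMx := Minimax.batchSize_le_mul (σ := σ) zero_le_one hκ1 hκ1 hε hε1
      rw [one_mul] at hMx
      have hMy := Minimax.batchSize_le_mul (σ := σ) hκ0 le_rfl hκ1 hε hε1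
      have hM0 : 0 ≤ κ * (1 + σ ^ 2) / ε ^ 2 := by positivity
      refine le_of_eq_of_le ?_ (Minimax.iterationCount_mul_le (C := 20000) (by norm_num) hκ1 hℓ
        ((sub_nonneg.2 (ciInf_le hb x₀)).trans hΔ₀) hc0 ((sq_nonneg _).trans hDx) hε hε1
        (by linarith : (Minimax.batchSize (σ ^ 2 / ε ^ 2) : ℝ)
          + Minimax.batchSize (κ * σ ^ 2 / ε ^ 2) ≤ _))
      rw [Minimax.ogdaOracleCalls, Finset.sum_const, Finset.card_range, smul_eq_mul]
      push_cast
      ring
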